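/- Let $S$ be a scheme, let $G$ be a finite group, and let $Z$ be an $S$-scheme with an action of $G$ by $S$-automorphisms. Let $\mathrm{Conj}(G)\subset G$ be a set of representatives of the conjugacy classes of $G$. For $g\in G$ let $C(g)$ be the centralizer of $g$ in $G$, and let $Z^g$ be the (scheme-theoretic) fixed locus of $g$, i.e. the equalizer of $g\colon Z\to Z$ and $\mathrm{id}_Z$, with the induced action of $C(g)$. For a finite group $H$ acting on an $S$-scheme $W$, let $[W/H]$ be the quotient stack: an object over an $S$-scheme $U$ is an $H$-torsor $P\to U$ (for the étale topology, $P$ a scheme) together with an $H$-equivariant $S$-morphism $P\to W$; a morphism over $U'\to U$ is an $H$-equivariant morphism $P'\to P$ compatible with the morphisms to $W$ which makes the square over $U'\to U$ cartesian. For a stack $\mathscr X$ over $(\mathrm{Sch}/S)$ let $I(\mathscr X)$ be its inertia stack: an object over $U$ is a pair $(\xi,\alpha)$ with $\xi\in\mathscr X(U)$ and $\alpha$ an automorphism of $\xi$ in the fibre category $\mathscr X(U)$; a morphism $(\xi,\alpha)\to(\eta,\beta)$ is a morphism $\gamma\colon\xi\to\eta$ of $\mathscr X$ with $\gamma\circ\alpha=\beta\circ\gamma$.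 For a family of stacks $(\mathscr X_i)_i$, an object of $\coprod_i\mathscr X_i$ over $U$ is a decomposition $U=\coprod_i U_i$ together with an object of $\mathscr X_i$ over $U_i$ for each $i$; a morphism over $f\colon U\to V$ is a family of morphisms in the $\mathscr X_i$ lying over morphisms $U_i\to V_i$ compatible with $f$. Then there is an isomorphism of stacks (an equivalence of categories over $(\mathrm{Sch}/S)$) $$I([Z/G])\;\cong\;\coprod_{g\in\mathrm{Conj}(G)}[Z^g/C(g)].$$ -/

import Mathlib

open CategoryTheory CategoryTheory.Limits AlgebraicGeometry

universe v₁ v₂ v₃ u₁ u₂ u₃ w u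

namespace StackTheory

noncomputable section

/-! ### Categories over a base: isomorphisms, inertia and disjoint unions -/

section General

variable {𝒮 : Type u₁} [Category.{v₁} 𝒮]

/-- An isomorphism of stacks, i.e. an equivalence of categories over the base `𝒮`: functors in
both directions which commute strictly with the projections to `𝒮`, mutually inverse up to
natural isomorphisms all of whose components lie over identities of `𝒮`. -/
structure BasedEquivalence (𝒳 : BasedCategory.{v₂, u₂} 𝒮) (𝒴 : BasedCategory.{v₃, u₃} 𝒮) where
  /-- The functor from left to right. -/
  functor : BasedFunctor 𝒳 𝒴
  /-- The functor from right to left. -/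
  inverse : BasedFunctor 𝒴 𝒳
  /-- The unit isomorphism. -/
  unitIso : BasedFunctor.id 𝒳 ≅ functor.comp inverse
  /-- The counit isomorphism. -/
  counitIso : inverse.comp functor ≅ BasedFunctor.id 𝒴

/-- An object of the inertia stack over `U`: an object `ξ` over `U` together with an automorphism
`α` of `ξ` in the fibre category over `U`. -/
structure InertiaObj (𝒳 : BasedCategory.{v₂, u₂} 𝒮) where
  /-- The underlying object. -/
  ξ : 𝒳.obj
  /-- The automorphism. -/
  α : ξ ≅ ξ
  /-- The automorphism lies over the identity. -/
  vertical : 𝒳.p.map α.hom = 𝟙 (𝒳.p.obj ξ)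

/-- A morphism `(ξ, α) ⟶ (η, β)` of the inertia stack: a morphism `γ : ξ ⟶ η`
with `γ ∘ α = β ∘ γ`. -/
@[ext]
structure InertiaHom {𝒳 : BasedCategory.{v₂, u₂} 𝒮} (a b : InertiaObj 𝒳) where
  /-- The underlying morphism. -/
  γ : a.ξ ⟶ b.ξ
  comm : a.α.hom ≫ γ = γ ≫ b.α.hom

instance inertiaCategory (𝒳 : BasedCategory.{v₂, u₂} 𝒮) : Category.{v₂} (InertiaObj 𝒳) where
  Hom a b := InertiaHom a b
  id a := ⟨𝟙 a.ξ, by simp⟩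
  comp f g := ⟨f.γ ≫ g.γ, by rw [← Category.assoc, f.comm, Category.assoc, g.comm,
    Category.assoc]⟩
  id_comp f := InertiaHom.ext (Category.id_comp f.γ)
  comp_id f := InertiaHom.ext (Category.comp_id f.γ)
  assoc f g h := InertiaHom.ext (Category.assoc f.γ g.γ h.γ)

/-- The inertia stack `I(𝒳)`, as a category over `𝒮`. -/
def inertia (𝒳 : BasedCategory.{v₂, u₂} 𝒮) : BasedCategory.{v₂, max u₂ v₂} 𝒮 where
  obj := InertiaObj 𝒳
  category := inertiaCategory 𝒳
  p :=
    { obj := fun a => 𝒳.p.obj a.ξ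
      map := fun f => 𝒳.p.map (InertiaHom.γ f)
      map_id := fun a => 𝒳.p.map_id a.ξ
      map_comp := fun f g => 𝒳.p.map_comp (InertiaHom.γ f) (InertiaHom.γ g) }

variable {I : Type w}

/-- An object over `U` of the disjoint union of the stacks `𝒳 i`: a decomposition of `U` as a
disjoint union (coproduct) of objects `U i` of the base, and for every `i` an object of `𝒳 i`
over `U i`. -/
structure DisjointUnionObj (𝒳 : I → BasedCategory.{v₂, u₂} 𝒮) where
  /-- The object of the base. -/
  U : 𝒮
  /-- The object of `𝒳 i` over the `i`-th piece. -/
  x : ∀ i, (𝒳 i).obj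
  /-- The inclusion of the `i`-th piece. -/
  ι : ∀ i, (𝒳 i).p.obj (x i) ⟶ U
  /-- The pieces form a disjoint union decomposition of `U`. -/
  isColimit : Nonempty (IsColimit (Cofan.mk U ι))

/-- A morphism over `f : U ⟶ V` in the disjoint union: a family of morphisms `x i ⟶ y i`
in the `𝒳 i` lying over morphisms `U i ⟶ V i` which are compatible with `f`. -/
@[ext]
structure DisjointUnionHom {𝒳 : I → BasedCategory.{v₂, u₂} 𝒮} (a b : DisjointUnionObj 𝒳) where
  /-- The morphism of the base. -/
  f : a.U ⟶ b.U
  /-- The morphisms on the pieces. -/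
  h : ∀ i, a.x i ⟶ b.x i
  comm : ∀ i, (𝒳 i).p.map (h i) ≫ b.ι i = a.ι i ≫ f

instance disjointUnionCategory (𝒳 : I → BasedCategory.{v₂, u₂} 𝒮) :
    Category.{max v₁ v₂ w} (DisjointUnionObj 𝒳) where
  Hom a b := DisjointUnionHom a b
  id a := ⟨𝟙 a.U, fun i => 𝟙 (a.x i), fun i => by simp⟩
  comp f g := ⟨f.f ≫ g.f, fun i => f.h i ≫ g.h i, fun i => by
    rw [Functor.map_comp, Category.assoc, g.comm, ← Category.assoc, f.comm, Category.assoc]⟩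
  id_comp f := DisjointUnionHom.ext (Category.id_comp _) (funext fun _ => Category.id_comp _)
  comp_id f := DisjointUnionHom.ext (Category.comp_id _) (funext fun _ => Category.comp_id _)
  assoc f g h := DisjointUnionHom.ext (Category.assoc _ _ _)
    (funext fun _ => Category.assoc _ _ _)

/-- The disjoint union `∐ i, 𝒳 i` of a family of stacks, as a category over `𝒮`. -/
def disjointUnion (𝒳 : I → BasedCategory.{v₂, u₂} 𝒮) :
    BasedCategory.{max v₁ v₂ w, max u₁ v₁ u₂ w} 𝒮 where
  obj := DisjointUnionObj 𝒳
  category := disjointUnionCategory 𝒳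
  p :=
    { obj := fun a => a.U
      map := fun f => DisjointUnionHom.f f
      map_id := fun _ => rfl
      map_comp := fun _ _ => rfl }

end General

/-! ### Torsors, quotient stacks and fixed loci -/

section Quotient

variable {S : Scheme.{u}} {G : Type w} [Group G]

/-- `π : P ⟶ U` is a torsor (for the étale topology) under the group `G`, regarded as a constant
group scheme: `π` is invariant, étale and surjective, and the map
`G × P = ∐ g, P ⟶ P ×[U] P`, `(g, p) ↦ (p, g p)`, is an isomorphism. -/
structure IsTorsor (P : Action (Over S) G) {U : Over S} (π : P.V ⟶ U) : Prop where
  invariant : ∀ g : G, (P.ρ g : P.V ⟶ P.V) ≫ π = π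
  etale : Etale π.left
  surjective : Surjective π.left
  simplyTransitive : Nonempty (IsColimit (Cofan.mk (pullback π π) fun g : G =>
    pullback.lift (𝟙 P.V) (P.ρ g : P.V ⟶ P.V) (by rw [invariant, Category.id_comp])))

/-- An object of `[Z/G]` over `U`: a `G`-torsor `P ⟶ U` with a `G`-equivariant morphism
`P ⟶ Z`. -/
structure QuotientObj (Z : Action (Over S) G) where
  /-- The base of the torsor. -/
  U : Over S
  /-- The total space of the torsor, with its action of `G`. -/
  P : Action (Over S) G
  /-- The projection of the torsor. -/
  π : P.V ⟶ U
  isTorsor : IsTorsor P π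
  /-- The equivariant morphism to `Z`. -/
  toZ : P ⟶ Z

/-- A morphism of `[Z/G]` over `φ : U' ⟶ U`: a cartesian square whose upper arrow `P' ⟶ P` is
`G`-equivariant and compatible with the morphisms to `Z`. -/
@[ext]
structure QuotientHom {Z : Action (Over S) G} (a b : QuotientObj Z) where
  /-- The morphism of the bases. -/
  φ : a.U ⟶ b.U
  /-- The equivariant morphism of the total spaces. -/
  ψ : a.P ⟶ b.P
  isPullback : IsPullback ψ.hom a.π b.π φ
  comm : ψ ≫ b.toZ = a.toZ

instance quotientCategory (Z : Action (Over S) G) : Category.{u} (QuotientObj Z) where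
  Hom a b := QuotientHom a b
  id a := ⟨𝟙 a.U, 𝟙 a.P, by
    rw [Action.id_hom]; exact IsPullback.of_horiz_isIso ⟨by simp⟩, Category.id_comp _⟩
  comp f g := ⟨f.φ ≫ g.φ, f.ψ ≫ g.ψ, f.isPullback.paste_horiz g.isPullback, by
    rw [Category.assoc, g.comm, f.comm]⟩
  id_comp f := QuotientHom.ext (Category.id_comp _) (Category.id_comp _)
  comp_id f := QuotientHom.ext (Category.comp_id _) (Category.comp_id _)
  assoc f g h := QuotientHom.ext (Category.assoc _ _ _) (Category.assoc _ _ _)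

/-- The quotient stack `[Z/G]`, as a category over the category of `S`-schemes. -/
def quotientStack (Z : Action (Over S) G) :
    BasedCategory.{u, max (u + 1) w} (Over S) where
  obj := QuotientObj Z
  category := quotientCategory Z
  p :=
    { obj := fun a => a.U
      map := fun f => QuotientHom.φ f
      map_id := fun _ => rfl
      map_comp := fun _ _ => rfl }

theorem fixedLocus_aux (Z : Action (Over S) G) (g : G) (h : Subgroup.centralizer {g}) :
    (equalizer.ι (Z.ρ g : Z.V ⟶ Z.V) (𝟙 Z.V) ≫ (Z.ρ (h : G) : Z.V ⟶ Z.V)) ≫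
        (Z.ρ g : Z.V ⟶ Z.V) =
      (equalizer.ι (Z.ρ g : Z.V ⟶ Z.V) (𝟙 Z.V) ≫ (Z.ρ (h : G) : Z.V ⟶ Z.V)) ≫ 𝟙 Z.V := by
  have hc : g * (h : G) = h * g := Subgroup.mem_centralizer_singleton_iff.mp h.2 |>.symm
  have e : (Z.ρ (h : G) : Z.V ⟶ Z.V) ≫ (Z.ρ g : Z.V ⟶ Z.V) =
      (Z.ρ g : Z.V ⟶ Z.V) ≫ (Z.ρ (h : G) : Z.V ⟶ Z.V) := by
    have := congrArg Z.ρ hc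
    rw [map_mul, map_mul] at this
    exact this
  rw [Category.assoc, e, ← Category.assoc, equalizer.condition]
  simp

/-- The fixed locus `Z^g`, i.e. the largest subscheme of `Z` on which `g` is the identity (the
equalizer of `g` and the identity of `Z`), with the action of the centralizer `C(g)` which is
induced by that of `G` on `Z`. -/
def fixedLocus (Z : Action (Over S) G) (g : G) :
    Action (Over S) (Subgroup.centralizer ({g} : Set G)) where
  V := equalizer (Z.ρ g : Z.V ⟶ Z.V) (𝟙 Z.V)
  ρ :=
    { toFun := fun h => equalizer.lift _ (fixedLocus_aux Z g h)
      map_one' := by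
        apply equalizer.hom_ext
        rw [equalizer.lift_ι, Subgroup.coe_one, map_one]
        exact (Category.comp_id _).trans (Category.id_comp _).symm
      map_mul' := fun h k => by
        apply equalizer.hom_ext
        rw [equalizer.lift_ι, Subgroup.coe_mul, map_mul, End.mul_def, End.mul_def,
          Category.assoc, equalizer.lift_ι, ← Category.assoc, ← Category.assoc,
          equalizer.lift_ι] }

end Quotient

end

end StackTheory

/-! Let `α` be an automorphism of a `G`-torsor `P` over `U`. At each point `p` it acts as a unique
`k` in `G`, `α p = k p`, and at `x p` it acts as `x k x⁻¹`. Let `Q_g` be the locus of `P` where `α =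
g`. It is open, being the preimage under `(1, α)` of the `g`-th component of `P ×_U P`; it is stable
under `C(g)`; and `P ⟶ Z` maps it into `Z^g` because that morphism is `α`-invariant.

On the translate `x Q_g` the automorphism is `x g x⁻¹`, and every element of `G` has this form for
exactly one `g` in `Conj` and one coset `x C(g)`. So `P` is the disjoint union of these translates,
that is, `P` is induced from the `Q_g` (`IsFixedFamily.isInduced`). Hence `U` is the disjoint union
of the images `U_g`, and `Q_g ⟶ U_g` is a `C(g)`-torsor (`isColimit_images`, `isTorsor_piece`).
Conversely, `C(g)`-torsors over the pieces of `U` induce a `G`-torsor, with `α` defined to be `g` on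
`Q_g` (`exists_comparison_left`).

Both constructions involve choices, so the equivalence is extracted from a relation: a `Comparison`
exhibits the pieces on one side as the loci `Q_g` on the other. Morphisms between compared objects
correspond bijectively (`Comparison.exists_left`, `Comparison.exists_right`), and every object has a
partner over the same base; `Correspondence.basedEquivalence` does the rest.

The geometry is tested on morphisms from one-point schemes. This suffices because factoring through
an open immersion, and being a disjoint union of open subschemes, are conditions on underlying sets.
-/

namespace StackTheory

/-! ### Equivalences over a base from correspondences. -/

section Correspondence

universe u₄

variable {𝒮 : Type u₁} [Category.{v₁} 𝒮]

/-- A correspondence between two categories over `𝒮`: a type of comparisons between objects, and a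
relation between morphisms of compared objects which is bijective on morphisms and essentially
total on objects on both sides. -/
structure Correspondence (𝒳 : BasedCategory.{v₂, u₂} 𝒮) (𝒴 : BasedCategory.{v₃, u₃} 𝒮) where
  /-- The comparisons between two objects. -/
  Rel : 𝒳.obj → 𝒴.obj → Type u₄
  /-- The isomorphism of bases underlying a comparison. -/
  base : ∀ {a y}, Rel a y → (𝒳.p.obj a ≅ 𝒴.p.obj y)
  /-- Compatibility of morphisms with comparisons. -/
  Compat : ∀ {a y a' y'}, Rel a y → Rel a' y' → (a ⟶ a') → (y ⟶ y') → Prop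
  compat_id : ∀ {a y} (r : Rel a y), Compat r r (𝟙 a) (𝟙 y)
  compat_comp : ∀ {a y a' y' a'' y''} {r : Rel a y} {r' : Rel a' y'} {r'' : Rel a'' y''}
    {F : a ⟶ a'} {F' : a' ⟶ a''} {f : y ⟶ y'} {f' : y' ⟶ y''},
    Compat r r' F f → Compat r' r'' F' f' → Compat r r'' (F ≫ F') (f ≫ f')
  compat_base : ∀ {a y a' y'} {r : Rel a y} {r' : Rel a' y'} {F : a ⟶ a'} {f : y ⟶ y'},
    Compat r r' F f → 𝒳.p.map F ≫ (base r').hom = (base r).hom ≫ 𝒴.p.map f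
  existsUnique_left : ∀ {a y a' y'} (r : Rel a y) (r' : Rel a' y') (f : y ⟶ y'),
    ∃! F : a ⟶ a', Compat r r' F f
  existsUnique_right : ∀ {a y a' y'} (r : Rel a y) (r' : Rel a' y') (F : a ⟶ a'),
    ∃! f : y ⟶ y', Compat r r' F f
  exists_left : ∀ y, ∃ (a : _) (r : Rel a y) (h : 𝒳.p.obj a = 𝒴.p.obj y), base r = eqToIso h
  exists_right : ∀ a, ∃ (y : _) (r : Rel a y) (h : 𝒳.p.obj a = 𝒴.p.obj y), base r = eqToIso h

namespace Correspondence

variable {𝒳 : BasedCategory.{v₂, u₂} 𝒮} {𝒴 : BasedCategory.{v₃, u₃} 𝒮}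
  (C : Correspondence.{v₁, v₂, v₃, u₁, u₂, u₃, u₄} 𝒳 𝒴)

/-- The opposite correspondence. -/
def symm : Correspondence.{v₁, v₃, v₂, u₁, u₃, u₂, u₄} 𝒴 𝒳 where
  Rel y a := C.Rel a y
  base r := (C.base r).symm
  Compat r r' f F := C.Compat r r' F f
  compat_id r := C.compat_id r
  compat_comp h h' := C.compat_comp h h'
  compat_base {y a y' a' r r' f F} h := by
    have := C.compat_base h
    simp only [Iso.symm_hom]
    rw [Iso.comp_inv_eq, Category.assoc, this, Iso.inv_hom_id_assoc]
  existsUnique_left r r' F := C.existsUnique_right r r' F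
  existsUnique_right r r' F := C.existsUnique_left r r' F
  exists_left a := by
    obtain ⟨y, r, h, e⟩ := C.exists_right a
    exact ⟨y, r, h.symm, by rw [e]; rfl⟩
  exists_right y := by
    obtain ⟨a, r, h, e⟩ := C.exists_left y
    exact ⟨a, r, h.symm, by rw [e]; rfl⟩

/-- A chosen object of the right hand side compared with a given one. -/
noncomputable def obj (a : 𝒳.obj) : 𝒴.obj := (C.exists_right a).choose

/-- The chosen comparison. -/
noncomputable def rel (a : 𝒳.obj) : C.Rel a (C.obj a) := (C.exists_right a).choose_spec.choose

lemma p_obj (a : 𝒳.obj) : 𝒳.p.obj a = 𝒴.p.obj (C.obj a) :=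
  (C.exists_right a).choose_spec.choose_spec.choose

lemma base_rel (a : 𝒳.obj) : C.base (C.rel a) = eqToIso (C.p_obj a) :=
  (C.exists_right a).choose_spec.choose_spec.choose_spec

/-- The morphism compatible with a given one. -/
noncomputable def map {a a' : 𝒳.obj} {y y' : 𝒴.obj} (r : C.Rel a y) (r' : C.Rel a' y')
    (F : a ⟶ a') : y ⟶ y' :=
  (C.existsUnique_right r r' F).choose

variable {C} in
lemma compat_map {a a' : 𝒳.obj} {y y' : 𝒴.obj} (r : C.Rel a y) (r' : C.Rel a' y') (F : a ⟶ a') :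
    C.Compat r r' F (C.map r r' F) :=
  (C.existsUnique_right r r' F).choose_spec.1

variable {C} in
lemma map_eq {a a' : 𝒳.obj} {y y' : 𝒴.obj} {r : C.Rel a y} {r' : C.Rel a' y'} {F : a ⟶ a'}
    {f : y ⟶ y'} (h : C.Compat r r' F f) : C.map r r' F = f :=
  (C.existsUnique_right r r' F).unique (compat_map r r' F) h

/-- The functor over the base which is defined by a correspondence. -/
noncomputable def functor : BasedFunctor 𝒳 𝒴 where
  obj := C.obj
  map F := C.map (C.rel _) (C.rel _) F
  map_id a := map_eq (C.compat_id _)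
  map_comp F F' := map_eq (C.compat_comp (compat_map _ _ F) (compat_map _ _ F'))
  w := by
    refine CategoryTheory.Functor.ext (fun a => (C.p_obj a).symm) fun a a' F => ?_
    have := C.compat_base (compat_map (C.rel a) (C.rel a') F)
    rw [base_rel, base_rel, eqToIso.hom, eqToIso.hom] at this
    simp only [Functor.comp_map, this, ← Category.assoc, eqToHom_trans, eqToHom_refl,
      Category.id_comp]

variable {C} in
lemma map_map {a a' a'' : 𝒳.obj} {y y' y'' : 𝒴.obj} (r : C.Rel a y) (r' : C.Rel a' y')
    (r'' : C.Rel a'' y'') (F : a ⟶ a') (F' : a' ⟶ a'') :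
    C.map r r' F ≫ C.map r' r'' F' = C.map r r'' (F ≫ F') :=
  (map_eq (C.compat_comp (compat_map r r' F) (compat_map r' r'' F'))).symm

variable {C} in
lemma map_id {a : 𝒳.obj} {y : 𝒴.obj} (r : C.Rel a y) : C.map r r (𝟙 a) = 𝟙 y :=
  map_eq (C.compat_id r)

/-- Two objects compared with the same object are isomorphic. -/
noncomputable def isoOfRel {a : 𝒳.obj} {y y' : 𝒴.obj} (r : C.Rel a y) (r' : C.Rel a y') :
    y ≅ y' where
  hom := C.map r r' (𝟙 a)
  inv := C.map r' r (𝟙 a)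
  hom_inv_id := by rw [map_map, Category.comp_id, map_id]
  inv_hom_id := by rw [map_map, Category.comp_id, map_id]

lemma p_isoOfRel {a : 𝒳.obj} {y y' : 𝒴.obj} (r : C.Rel a y) (r' : C.Rel a y')
    (h : 𝒳.p.obj a = 𝒴.p.obj y) (e : C.base r = eqToIso h)
    (h' : 𝒳.p.obj a = 𝒴.p.obj y') (e' : C.base r' = eqToIso h') :
    𝒴.p.map (C.isoOfRel r r').hom = eqToHom (h.symm.trans h') := by
  have := C.compat_base (compat_map r r' (𝟙 a))
  rw [e, e', CategoryTheory.Functor.map_id, Category.id_comp, eqToIso.hom, eqToIso.hom] at this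
  rw [← cancel_epi (eqToHom h), eqToHom_trans]
  exact this.symm

/-- Both composites are the unique morphism compatible with `F` for the comparisons `r` and `s'`. -/
lemma map_naturality {a a' : 𝒳.obj} {y z y' z' : 𝒴.obj} (r : C.Rel a y) (s : C.Rel a z)
    (r' : C.Rel a' y') (s' : C.Rel a' z') (F : a ⟶ a') (f : z ⟶ z') (h : C.Compat s s' F f) :
    C.map r r' F ≫ (C.isoOfRel r' s').hom = (C.isoOfRel r s).hom ≫ f := by
  rw [← map_eq h]
  exact (map_map _ _ _ _ _).trans
    (Eq.trans (by rw [Category.comp_id, Category.id_comp]) (map_map _ _ _ _ _).symm)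

lemma base_symm_rel (y : 𝒴.obj) :
    C.base (C.symm.rel y : C.Rel (C.symm.obj y) y) = eqToIso (C.symm.p_obj y).symm :=
  congrArg Iso.symm (C.symm.base_rel y)

/-- The counit of the equivalence defined by a correspondence. -/
noncomputable def counitIso : C.symm.functor.comp C.functor ≅ BasedFunctor.id 𝒴 :=
  BasedNatIso.mkNatIso
    (NatIso.ofComponents
      (fun y => C.isoOfRel (C.rel (C.symm.obj y)) (C.symm.rel y : C.Rel (C.symm.obj y) y))
      (fun {y y'} f => C.map_naturality (C.rel _) (C.symm.rel y : C.Rel (C.symm.obj y) y) (C.rel _)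
        (C.symm.rel y' : C.Rel (C.symm.obj y') y') (C.symm.functor.map f) f
        (compat_map (C := C.symm) (C.symm.rel y) (C.symm.rel y') f)))
    (fun y => by
      refine IsHomLift.of_fac _ _ _ (((C.symm.p_obj y).trans (C.p_obj _)).symm) rfl ?_
      refine Eq.symm ((congrArg _ (congrArg (· ≫ _) (C.p_isoOfRel _ _ _ (C.base_rel _) _
        (C.base_symm_rel y)))).trans ?_)
      exact (congrArg _ (eqToHom_trans _ _)).trans (eqToHom_trans _ _))

/-- The equivalence over the base which is defined by a correspondence. -/
noncomputable def basedEquivalence : BasedEquivalence 𝒳 𝒴 where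
  functor := C.functor
  inverse := C.symm.functor
  -- `C.symm.symm` unfolds to `C`, so the counit of the opposite correspondence serves as the unit.
  unitIso := C.symm.counitIso.symm
  counitIso := C.counitIso

end Correspondence

end Correspondence

/-! ### Testing morphisms of schemes on one-point schemes. -/

section OnePoint

variable {S : Scheme.{u}}

/-- An `S`-scheme whose underlying space is a point. -/
def IsOnePoint (κ : Over S) : Prop := ∃ p : κ.left, ∀ q : κ.left, q = p

lemma comp_left_apply {X Y T : Over S} (f : X ⟶ Y) (g : Y ⟶ T) (x : X.left) :
    (f ≫ g).left x = g.left (f.left x) := by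
  rw [Over.comp_left, Scheme.Hom.comp_apply]

lemma over_mono {X Y : Over S} (f : X ⟶ Y) [IsOpenImmersion f.left] : Mono f :=
  (Over.forget S).mono_of_mono_map (f := f) (inferInstanceAs (Mono f.left))

lemma exists_onePoint {X : Over S} (x : X.left) :
    ∃ (κ : Over S) (t : κ ⟶ X), IsOnePoint κ ∧ ∀ q, t.left q = x := by
  refine ⟨Over.mk (X.left.fromSpecResidueField x ≫ X.hom),
    Over.homMk (X.left.fromSpecResidueField x), ?_, fun q => ?_⟩
  · let p : Spec (X.left.residueField x) := default
    exact ⟨p, fun q => Subsingleton.elim (α := Spec (X.left.residueField x)) q p⟩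
  · exact Scheme.fromSpecResidueField_apply x q

/-- Two points with the same image come from a point of the fibre product; `κ` is the spectrum of
its residue field. -/
lemma exists_onePoint_pullback {X Y U : Over S} (f : X ⟶ U) (g : Y ⟶ U) (x : X.left) (y : Y.left)
    (h : f.left x = g.left y) :
    ∃ (κ : Over S) (s : κ ⟶ X) (t : κ ⟶ Y), IsOnePoint κ ∧ s ≫ f = t ≫ g ∧
      (∀ q, s.left q = x) ∧ ∀ q, t.left q = y := by
  obtain ⟨z, hz, hz'⟩ := Scheme.Pullback.exists_preimage_pullback x y h
  let W : Over S := Over.mk (pullback.fst f.left g.left ≫ X.hom)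
  let a : W ⟶ X := Over.homMk (pullback.fst f.left g.left)
  let b : W ⟶ Y := Over.homMk (pullback.snd f.left g.left) (by
    change _ ≫ Y.hom = pullback.fst f.left g.left ≫ X.hom
    rw [← Over.w f, ← Over.w g, pullback.condition_assoc])
  obtain ⟨κ, t, hκ, ht⟩ := exists_onePoint (X := W) z
  refine ⟨κ, t ≫ a, t ≫ b, hκ, ?_, fun q => ?_, fun q => ?_⟩
  · rw [Category.assoc, Category.assoc]
    congr 1
    ext1
    exact pullback.condition
  · rw [comp_left_apply, ht]
    exact hz
  · rw [comp_left_apply, ht]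
    exact hz'

lemma exists_lift_of_range_subset {X Y T : Over S} (j : Y ⟶ X) [IsOpenImmersion j.left] (t : T ⟶ X)
    (h : Set.range t.left ⊆ Set.range j.left) : ∃ l : T ⟶ Y, l ≫ j = t := by
  refine ⟨Over.homMk (IsOpenImmersion.lift j.left t.left h) ?_, ?_⟩
  · rw [← Over.w j, IsOpenImmersion.lift_fac_assoc, Over.w t]
  · ext1
    exact IsOpenImmersion.lift_fac _ _ _

lemma IsOnePoint.exists_lift {X Y κ : Over S} (hκ : IsOnePoint κ) (j : Y ⟶ X)
    [IsOpenImmersion j.left] (t : κ ⟶ X) {q : κ.left} {y : Y.left} (h : t.left q = j.left y) :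
    ∃ l : κ ⟶ Y, l ≫ j = t := by
  refine exists_lift_of_range_subset j t ?_
  rintro _ ⟨q', rfl⟩
  obtain ⟨p, hp⟩ := hκ
  rw [hp q', ← hp q]
  exact ⟨y, h.symm⟩

/-- Factoring through an open immersion only depends on the set-theoretic image, which one-point
schemes detect. -/
lemma exists_lift_of_onePoint {X Y T : Over S} (j : Y ⟶ X) [IsOpenImmersion j.left] (t : T ⟶ X)
    (h : ∀ (κ : Over S) (s : κ ⟶ T), IsOnePoint κ → ∃ l : κ ⟶ Y, l ≫ j = s ≫ t) :
    ∃ l : T ⟶ Y, l ≫ j = t := by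
  refine exists_lift_of_range_subset j t ?_
  rintro _ ⟨x, rfl⟩
  obtain ⟨κ, s, hκ, hs⟩ := exists_onePoint x
  obtain ⟨l, hl⟩ := h κ s hκ
  obtain ⟨p, -⟩ := hκ
  refine ⟨l.left p, ?_⟩
  rw [← comp_left_apply, hl, comp_left_apply, hs]

/-- Points lift along a surjection only after a further extension of the residue field, hence the
passage from `κ` to `κ'`. -/
lemma IsOnePoint.exists_lift_of_surjective {X U κ : Over S} (hκ : IsOnePoint κ) (f : X ⟶ U)
    (hf : Surjective f.left) (t : κ ⟶ U) :
    ∃ (κ' : Over S) (c : κ' ⟶ κ) (x : κ' ⟶ X), IsOnePoint κ' ∧ x ≫ f = c ≫ t := by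
  obtain ⟨p, -⟩ := hκ
  obtain ⟨x, hx⟩ := hf.surj (t.left p)
  obtain ⟨κ', s, c, hκ', h, -⟩ := exists_onePoint_pullback f t x p hx
  exact ⟨κ', c, s, hκ', h⟩

/-! ### Finite disjoint unions of `S`-schemes. -/

section Coproduct

variable {J : Type w} [Finite J] {X : J → Over S} {P : Over S} {i : ∀ j, X j ⟶ P}

open scoped Function in
lemma nonempty_isColimit_cofan (hi : ∀ j, IsOpenImmersion (i j).left)
    (hcov : ∀ (κ : Over S) (t : κ ⟶ P), IsOnePoint κ → ∃ (j : J) (l : κ ⟶ X j), l ≫ i j = t)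
    (hdisj : ∀ (κ : Over S) (j j' : J) (l : κ ⟶ X j) (l' : κ ⟶ X j'), IsOnePoint κ →
      l ≫ i j = l' ≫ i j' → j = j') :
    Nonempty (IsColimit (Cofan.mk P i)) := by
  have h := nonempty_isColimit_cofanMk_of (fun j => (i j).left) (by
      rw [eq_top_iff]
      intro x _
      obtain ⟨κ, t, hκ, ht⟩ := exists_onePoint x
      obtain ⟨j, l, hl⟩ := hcov κ t hκ
      obtain ⟨p, -⟩ := hκ
      rw [TopologicalSpace.Opens.mem_iSup]
      refine ⟨j, l.left p, ?_⟩
      have := comp_left_apply l (i j) p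
      rw [hl, ht] at this
      exact this.symm) (by
      intro j j' hjj'
      rw [Function.onFun, ← TopologicalSpace.Opens.coe_disjoint, Set.disjoint_left]
      rintro _ ⟨x, rfl⟩ ⟨y, hy⟩
      obtain ⟨κ, s, t, hκ, h, -⟩ := exists_onePoint_pullback (i j) (i j') x y hy.symm
      exact hjj' (hdisj κ j j' s t hκ h))
  exact h.map fun h => isColimitOfIsColimitCofanMkObj (Over.forget S) X i h

variable (h : IsColimit (Cofan.mk P i))
include h

lemma isColimit_cofan_left : Nonempty (IsColimit (Cofan.mk P.left fun j => (i j).left)) :=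
  ⟨isColimitCofanMkObjOfIsColimit (Over.forget S) X i h⟩

lemma isColimit_cofan_eq (j : J) :
    (i j).left = Sigma.ι (fun j => (X j).left) j ≫ ((coproductIsCoproduct _).coconePointUniqueUpToIso
      (isColimit_cofan_left h).some).hom :=
  ((coproductIsCoproduct _).comp_coconePointUniqueUpToIso_hom
      (isColimit_cofan_left h).some ⟨j⟩).symm

lemma isOpenImmersion_of_isColimit (j : J) : IsOpenImmersion (i j).left := by
  rw [isColimit_cofan_eq h]
  infer_instance

lemma exists_eq_of_isColimit (x : P.left) : ∃ (j : J) (y : (X j).left), (i j).left y = x := by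
  let e := (coproductIsCoproduct _).coconePointUniqueUpToIso (isColimit_cofan_left h).some
  obtain ⟨j, y, hy⟩ : ∃ (j : J) (y : (X j).left), Sigma.ι (fun j => (X j).left) j y = e.inv x :=
    (sigmaOpenCover fun j => (X j).left).exists_eq (e.inv x)
  refine ⟨j, y, ?_⟩
  rw [isColimit_cofan_eq h, Scheme.Hom.comp_apply]
  refine (congrArg e.hom hy).trans ?_
  rw [← Scheme.Hom.comp_apply, e.inv_hom_id]
  rfl

lemma eq_of_isColimit {j j' : J} {y : (X j).left} {y' : (X j').left}
    (hy : (i j).left y = (i j').left y') : j = j' := by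
  rw [isColimit_cofan_eq h, isColimit_cofan_eq h, Scheme.Hom.comp_apply,
    Scheme.Hom.comp_apply] at hy
  have := (ConcreteCategory.bijective_of_isIso
    ((coproductIsCoproduct fun j => (X j).left).coconePointUniqueUpToIso
      (isColimit_cofan_left h).some).hom.base).1 hy
  exact congrArg Sigma.fst ((sigmaι_eq_iff _ _ _ _ _).mp this)

lemma IsOnePoint.exists_lift_of_isColimit {κ : Over S} (hκ : IsOnePoint κ) (t : κ ⟶ P) :
    ∃ (j : J) (l : κ ⟶ X j), l ≫ i j = t := by
  obtain ⟨p, -⟩ := id hκ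
  obtain ⟨j, y, hy⟩ := exists_eq_of_isColimit h (t.left p)
  have := isOpenImmersion_of_isColimit h j
  exact ⟨j, hκ.exists_lift (i j) t hy.symm⟩

lemma IsOnePoint.eq_of_isColimit {κ : Over S} (hκ : IsOnePoint κ) {j j' : J} (l : κ ⟶ X j)
    (l' : κ ⟶ X j') (hl : l ≫ i j = l' ≫ i j') : j = j' := by
  obtain ⟨p, -⟩ := hκ
  refine StackTheory.eq_of_isColimit h (y := l.left p) (y' := l'.left p) ?_
  rw [← comp_left_apply, hl, comp_left_apply]

lemma etale_of_isColimit {U : Over S} (π : P ⟶ U) (hπ : ∀ j, Etale (i j ≫ π).left) :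
    Etale π.left := by
  let e := (coproductIsCoproduct _).coconePointUniqueUpToIso (isColimit_cofan_left h).some
  have : IsZariskiLocalAtSource @Etale :=
    HasRingHomProperty.instIsZariskiLocalAtSource (P := @Etale)
  have : Etale (Sigma.desc fun j => (i j ≫ π).left) := IsZariskiLocalAtSource.sigmaDesc hπ
  have he : π.left = e.inv ≫ Sigma.desc fun j => (i j ≫ π).left := by
    rw [Iso.eq_inv_comp]
    refine Sigma.hom_ext _ _ fun j => ?_
    rw [Sigma.ι_desc, Over.comp_left, isColimit_cofan_eq h, Category.assoc]
  rw [he]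
  infer_instance

end Coproduct

lemma isOpenImmersion_of_isPullback {A B C D : Over S} {f : A ⟶ B} {g : A ⟶ C} {h : B ⟶ D}
    {k : C ⟶ D} (H : IsPullback f g h k) (hh : IsOpenImmersion h.left) : IsOpenImmersion g.left :=
  MorphismProperty.of_isPullback (P := @IsOpenImmersion) (H.map (Over.forget S)) hh

lemma etale_of_isPullback {A B C D : Over S} {f : A ⟶ B} {g : A ⟶ C} {h : B ⟶ D}
    {k : C ⟶ D} (H : IsPullback f g h k) (hh : Etale h.left) : Etale g.left :=
  MorphismProperty.of_isPullback (P := @Etale) (H.map (Over.forget S)) hh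

lemma etale_of_comp_openImmersion {A B C : Over S} (f : A ⟶ B) (g : B ⟶ C)
    (h : Etale (f ≫ g).left) (hg : IsOpenImmersion g.left) : Etale f.left := by
  have : Etale (f.left ≫ g.left) := h
  exact Etale.of_comp f.left g.left

/-- A section of an étale morphism is an open immersion. -/
lemma isOpenImmersion_of_section {A B : Over S} (s : A ⟶ B) (f : B ⟶ A) (hf : Etale f.left)
    (h : s ≫ f = 𝟙 A) : IsOpenImmersion s.left := by
  have h1 : s.left ≫ f.left = 𝟙 A.left := congrArg CommaMorphism.left h
  have hP : MorphismProperty.HasOfPostcompProperty @IsOpenImmersion @Etale :=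
    -- The diagonal of an étale morphism is an open immersion, so `s` is one as soon as `s ≫ f` is.
    MorphismProperty.hasOfPostcompProperty_iff_le_diagonal.mpr fun X Y f (hf : Etale f) =>
      inferInstanceAs (IsOpenImmersion (pullback.diagonal f))
  refine MorphismProperty.of_postcomp (W := @IsOpenImmersion) (W' := @Etale) s.left f.left hf ?_
  rw [h1]
  infer_instance

end OnePoint

/-! ### Torsors and their points. -/

section Torsor

variable {S : Scheme.{u}} {G : Type w} [Group G] [Finite G]

/-- The pair `(p, p')` is a point of `P ×_U P`, which is the disjoint union of the graphs of the
`g`; a one-point scheme lands in one of them. -/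
lemma IsTorsor.exists_rho {P : Action (Over S) G} {U : Over S} {π : P.V ⟶ U} (h : IsTorsor P π)
    {κ : Over S} (hκ : IsOnePoint κ) (p p' : κ ⟶ P.V) (hp : p ≫ π = p' ≫ π) :
    ∃ g : G, p' = p ≫ (P.ρ g : P.V ⟶ P.V) := by
  obtain ⟨g, l, hl⟩ := hκ.exists_lift_of_isColimit h.simplyTransitive.some (pullback.lift p p' hp)
  have h1 := congrArg (· ≫ pullback.fst π π) hl
  have h2 := congrArg (· ≫ pullback.snd π π) hl
  simp only [Category.assoc, pullback.lift_fst, pullback.lift_snd, Category.comp_id] at h1 h2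
  exact ⟨g, by rw [← h2, h1]⟩

lemma IsTorsor.eq_of_comp_rho {P : Action (Over S) G} {U : Over S} {π : P.V ⟶ U}
    (h : IsTorsor P π) {κ : Over S} (hκ : IsOnePoint κ) (p : κ ⟶ P.V) {g g' : G}
    (hp : p ≫ (P.ρ g : P.V ⟶ P.V) = p ≫ (P.ρ g' : P.V ⟶ P.V)) : g = g' := by
  refine hκ.eq_of_isColimit h.simplyTransitive.some p p ?_
  apply pullback.hom_ext
  · simp only [Category.assoc, pullback.lift_fst]
  · simp only [Category.assoc, pullback.lift_snd, hp]

/-- Torsors can be recognized on points. -/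
lemma isTorsor_of_onePoint (P : Action (Over S) G) {U : Over S} (π : P.V ⟶ U)
    (hinv : ∀ g : G, (P.ρ g : P.V ⟶ P.V) ≫ π = π) (het : Etale π.left) (hsurj : Surjective π.left)
    (htrans : ∀ (κ : Over S) (p p' : κ ⟶ P.V), IsOnePoint κ → p ≫ π = p' ≫ π →
      ∃ g : G, p' = p ≫ (P.ρ g : P.V ⟶ P.V))
    (hfree : ∀ (κ : Over S) (p : κ ⟶ P.V) (g g' : G), IsOnePoint κ →
      p ≫ (P.ρ g : P.V ⟶ P.V) = p ≫ (P.ρ g' : P.V ⟶ P.V) → g = g') : IsTorsor P π where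
  invariant := hinv
  etale := het
  surjective := hsurj
  simplyTransitive := by
    refine nonempty_isColimit_cofan (fun g => ?_) (fun κ t hκ => ?_) fun κ g g' l l' hκ hl => ?_
    -- The graph of `g` is a section of the first projection, which is étale by base change.
    · exact isOpenImmersion_of_section _ (pullback.fst π π)
        (etale_of_isPullback (IsPullback.of_hasPullback π π).flip het) (pullback.lift_fst _ _ _)
    · obtain ⟨g, hg⟩ := htrans κ (t ≫ pullback.fst π π) (t ≫ pullback.snd π π) hκ (by
        rw [Category.assoc, Category.assoc, pullback.condition])
      refine ⟨g, t ≫ pullback.fst π π, ?_⟩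
      apply pullback.hom_ext
      · simp only [Category.assoc, pullback.lift_fst, Category.comp_id]
      · simp only [Category.assoc, pullback.lift_snd, hg]
    · have h1 := congrArg (· ≫ pullback.fst π π) hl
      have h2 := congrArg (· ≫ pullback.snd π π) hl
      simp only [Category.assoc, pullback.lift_fst, pullback.lift_snd, Category.comp_id] at h1 h2
      subst h1
      exact hfree κ l g g' hκ h2

end Torsor

/-! ### Induced actions. -/

section Induced

variable {𝒞 : Type u₁} [Category.{v₁} 𝒞] {G : Type w} [Group G] {I : Type w} {H : I → Subgroup G}

lemma action_rho_mul {K : Type*} [Group K] (P : Action 𝒞 K) (g h : K) :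
    (P.ρ h : P.V ⟶ P.V) ≫ (P.ρ g : P.V ⟶ P.V) = P.ρ (g * h) := by
  rw [map_mul]; rfl

lemma action_rho_mul_assoc {K : Type*} [Group K] (P : Action 𝒞 K) (g h : K) {X : 𝒞}
    (f : P.V ⟶ X) :
    (P.ρ h : P.V ⟶ P.V) ≫ (P.ρ g : P.V ⟶ P.V) ≫ f = (P.ρ (g * h) : P.V ⟶ P.V) ≫ f := by
  rw [← Category.assoc, action_rho_mul]

lemma action_rho_one {K : Type*} [Group K] (P : Action 𝒞 K) : (P.ρ 1 : P.V ⟶ P.V) = 𝟙 P.V := by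
  rw [map_one]; rfl

/-- `P` is the disjoint union over `i` of the actions of `G` which are induced by the actions `Q i`
of the subgroups `H i`: it is the coproduct of the translates of the `Q i`. -/
structure IsInduced (P : Action 𝒞 G) (Q : ∀ i, Action 𝒞 (H i)) (j : ∀ i, (Q i).V ⟶ P.V) :
    Prop where
  equivariant : ∀ i (h : H i),
    ((Q i).ρ h : (Q i).V ⟶ (Q i).V) ≫ j i = j i ≫ (P.ρ (h : G) : P.V ⟶ P.V)
  isColimit : Nonempty (IsColimit (Cofan.mk P.V fun k : Σ i, G ⧸ H i =>
    j k.1 ≫ (P.ρ k.2.out : P.V ⟶ P.V)))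

lemma action_rho_isIso {K : Type*} [Group K] (P : Action 𝒞 K) (g : K) :
    IsIso (P.ρ g : P.V ⟶ P.V) :=
  ⟨P.ρ g⁻¹, by rw [action_rho_mul, inv_mul_cancel, action_rho_one],
    by rw [action_rho_mul, mul_inv_cancel, action_rho_one]⟩

namespace IsInduced

variable {P : Action 𝒞 G} {Q : ∀ i, Action 𝒞 (H i)} {j : ∀ i, (Q i).V ⟶ P.V}

lemma exists_out_mul (K : Subgroup G) (x : G) : ∃ z : K, x = (x : G ⧸ K).out * z := by
  obtain ⟨z, hz⟩ := QuotientGroup.mk_out_eq_mul K x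
  exact ⟨z⁻¹, by rw [hz, mul_assoc, ← Subgroup.coe_mul, mul_inv_cancel, Subgroup.coe_one, mul_one]⟩

lemma comp_rho_mul (hP : IsInduced P Q j) (i : I) (x : G) (z : H i) :
    j i ≫ (P.ρ (x * z) : P.V ⟶ P.V) =
      ((Q i).ρ z : (Q i).V ⟶ (Q i).V) ≫ j i ≫ (P.ρ x : P.V ⟶ P.V) := by
  rw [← Category.assoc, hP.equivariant, Category.assoc, action_rho_mul]

lemma hom_ext (hP : IsInduced P Q j) {X : 𝒞} {f f' : P.V ⟶ X}
    (h : ∀ i (x : G), j i ≫ (P.ρ x : P.V ⟶ P.V) ≫ f = j i ≫ (P.ρ x : P.V ⟶ P.V) ≫ f') :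
    f = f' := by
  refine Cofan.IsColimit.hom_ext hP.isColimit.some _ _ fun k => ?_
  simpa using h k.1 k.2.out

lemma action_hom_ext (hP : IsInduced P Q j) {T : Action 𝒞 G} {f f' : P ⟶ T}
    (h : ∀ i, j i ≫ f.hom = j i ≫ f'.hom) : f = f' := by
  ext1
  refine hP.hom_ext fun i x => ?_
  rw [f.comm, f'.comm, ← Category.assoc, h, Category.assoc]

/-- Frobenius reciprocity: `m i` determines the morphism `x q ↦ x (m i q)` on the translates. -/
lemma exists_desc (hP : IsInduced P Q j) (T : Action 𝒞 G) (m : ∀ i, (Q i).V ⟶ T.V)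
    (hm : ∀ i (h : H i),
      ((Q i).ρ h : (Q i).V ⟶ (Q i).V) ≫ m i = m i ≫ (T.ρ (h : G) : T.V ⟶ T.V)) :
    ∃ ψ : P ⟶ T, ∀ i, j i ≫ ψ.hom = m i := by
  let d : P.V ⟶ T.V := Cofan.IsColimit.desc hP.isColimit.some
    fun k => m k.1 ≫ (T.ρ k.2.out : T.V ⟶ T.V)
  -- The formula holds for the chosen coset representatives by construction; equivariance of `m i`
  -- under `H i` extends it to all `x`.
  have hd (i : I) (x : G) :
      j i ≫ (P.ρ x : P.V ⟶ P.V) ≫ d = m i ≫ (T.ρ x : T.V ⟶ T.V) := by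
    obtain ⟨z, hz⟩ := exists_out_mul (H i) x
    have h1 : (j i ≫ (P.ρ (x : G ⧸ H i).out : P.V ⟶ P.V)) ≫ d =
        m i ≫ (T.ρ (x : G ⧸ H i).out : T.V ⟶ T.V) :=
      Cofan.IsColimit.fac hP.isColimit.some _ (⟨i, x⟩ : Σ i, G ⧸ H i)
    rw [hz, ← Category.assoc, hP.comp_rho_mul, Category.assoc, h1, ← Category.assoc, hm,
      Category.assoc, action_rho_mul]
  refine ⟨⟨d, fun g => ?_⟩, fun i => ?_⟩
  · refine hP.hom_ext fun i x => ?_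
    rw [action_rho_mul_assoc, hd, ← action_rho_mul, ← Category.assoc, ← hd, Category.assoc,
      Category.assoc]
  · have := hd i 1
    rwa [action_rho_one, action_rho_one, Category.id_comp, Category.comp_id] at this

lemma exists_desc_invariant (hP : IsInduced P Q j) {X : 𝒞} (m : ∀ i, (Q i).V ⟶ X)
    (hm : ∀ i (h : H i), ((Q i).ρ h : (Q i).V ⟶ (Q i).V) ≫ m i = m i) :
    ∃ d : P.V ⟶ X, (∀ x : G, (P.ρ x : P.V ⟶ P.V) ≫ d = d) ∧ ∀ i, j i ≫ d = m i := by
  obtain ⟨d, hd⟩ := hP.exists_desc (Action.trivial G X) m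
    fun i h => (hm i h).trans (Category.comp_id _).symm
  exact ⟨d.hom, fun x => (d.comm x).trans (Category.comp_id _), hd⟩

end IsInduced

section Existence

variable (Q : ∀ i, Action 𝒞 (H i)) [HasCoproduct fun k : Σ i, G ⧸ H i => (Q k.1).V]

/-- The translate by `x` of the piece `Q i` of the induced action, for `x` in the coset `c`. -/
noncomputable def translate (i : I) (c : G ⧸ H i) (x : G) (hx : (x : G ⧸ H i) = c) :
    (Q i).V ⟶ ∐ fun k : Σ i, G ⧸ H i => (Q k.1).V :=
  ((Q i).ρ ⟨c.out⁻¹ * x, QuotientGroup.eq.mp (by rw [hx, QuotientGroup.out_eq'])⟩ :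
    (Q i).V ⟶ (Q i).V) ≫ Sigma.ι (fun k : Σ i, G ⧸ H i => (Q k.1).V) ⟨i, c⟩

/-- This is `x (z q) = (x z) q`. Allowing arbitrary coset representatives in `translate` lets the
group laws be verified without a cocycle for the chosen ones. -/
lemma rho_translate (i : I) {c c' : G ⧸ H i} {x x' : G} (hx : (x : G ⧸ H i) = c)
    (hx' : (x' : G ⧸ H i) = c') (z : H i) (h : x * z = x') :
    ((Q i).ρ z : (Q i).V ⟶ (Q i).V) ≫ translate Q i c x hx = translate Q i c' x' hx' := by
  obtain rfl : c = c' := by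
    rw [← hx, ← hx', ← h]
    exact (QuotientGroup.mk_mul_of_mem x z.2).symm
  rw [translate, action_rho_mul_assoc, translate]
  congr 3
  exact Subtype.ext ((mul_assoc _ _ _).trans (congrArg _ h))

lemma translate_out (i : I) (c : G ⧸ H i) (hc : (c.out : G ⧸ H i) = c) :
    translate Q i c c.out hc = Sigma.ι (fun k : Σ i, G ⧸ H i => (Q k.1).V) ⟨i, c⟩ := by
  rw [translate]
  have : (⟨c.out⁻¹ * c.out, QuotientGroup.eq.mp (by rw [hc])⟩ : H i) = 1 :=
    Subtype.ext (inv_mul_cancel c.out)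
  rw [this, action_rho_one, Category.id_comp]

/-- Left translation on the induced action. -/
noncomputable def leftTranslation (y : G) :
    (∐ fun k : Σ i, G ⧸ H i => (Q k.1).V) ⟶ ∐ fun k : Σ i, G ⧸ H i => (Q k.1).V :=
  Sigma.desc fun k => translate Q k.1 _ (y * k.2.out) rfl

lemma translate_leftTranslation (i : I) {c c' : G ⧸ H i} {x x' : G} (hx : (x : G ⧸ H i) = c)
    (hx' : (x' : G ⧸ H i) = c') (y : G) (h : y * x = x') :
    translate Q i c x hx ≫ leftTranslation Q y = translate Q i c' x' hx' := by
  rw [translate, Category.assoc, leftTranslation, Sigma.ι_desc]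
  refine rho_translate Q i rfl hx' _ ?_
  rw [← h]
  simp [mul_assoc]

/-- The induced action. -/
noncomputable def inducedAction : Action 𝒞 G where
  V := ∐ fun k : Σ i, G ⧸ H i => (Q k.1).V
  ρ :=
    { toFun := fun y => leftTranslation Q y
      map_one' := by
        refine Sigma.hom_ext _ _ fun k => ?_
        have hk := QuotientGroup.out_eq' k.2
        rw [← translate_out Q k.1 k.2 hk, translate_leftTranslation Q k.1 hk hk 1 (one_mul _)]
        exact (Category.comp_id _).symm
      map_mul' := fun y y' => by
        refine Sigma.hom_ext _ _ fun k => ?_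
        have hk := QuotientGroup.out_eq' k.2
        rw [← translate_out Q k.1 k.2 hk, translate_leftTranslation Q k.1 hk rfl (y * y') rfl,
          End.mul_def, ← Category.assoc, translate_leftTranslation Q k.1 hk rfl y' rfl,
          translate_leftTranslation Q k.1 rfl rfl y (mul_assoc _ _ _).symm] }

lemma isInduced_inducedAction :
    IsInduced (inducedAction Q) Q fun i => translate Q i _ 1 rfl := by
  refine ⟨fun i h => ?_, ?_⟩
  · exact (rho_translate Q i rfl rfl h (one_mul _)).trans
      (translate_leftTranslation Q i rfl rfl (h : G) (mul_one _)).symm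
  · have (k : Σ i, G ⧸ H i) : translate Q k.1 _ 1 rfl ≫ leftTranslation Q k.2.out =
        Sigma.ι (fun k : Σ i, G ⧸ H i => (Q k.1).V) k := by
      rw [← translate_out Q k.1 k.2 (QuotientGroup.out_eq' k.2)]
      exact translate_leftTranslation Q k.1 rfl _ _ (mul_one _)
    refine ⟨IsColimit.ofIsoColimit (coproductIsCoproduct _) (Cofan.ext (Iso.refl _) fun k => ?_)⟩
    exact (Category.comp_id _).trans (this k).symm

end Existence

end Induced

/-! ### Points of induced actions. -/

section InducedPoints

variable {S : Scheme.{u}} {G : Type w} [Group G] [Finite G] {I : Type w} [Finite I]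
  {H : I → Subgroup G} {P : Action (Over S) G} {Q : ∀ i, Action (Over S) (H i)}
  {j : ∀ i, (Q i).V ⟶ P.V}

namespace IsInduced

variable (hP : IsInduced P Q j)
include hP

/-- The chosen representative of the trivial coset need not be `1`, so `j i` is a coproduct
inclusion only up to an automorphism of `Q i`. -/
lemma isOpenImmersion (i : I) : IsOpenImmersion (j i).left := by
  obtain ⟨z, hz⟩ := exists_out_mul (H i) 1
  have h := isOpenImmersion_of_isColimit hP.isColimit.some ⟨i, ((1 : G) : G ⧸ H i)⟩
  have h1 : j i = ((Q i).ρ z : (Q i).V ⟶ (Q i).V) ≫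
      j i ≫ (P.ρ ((1 : G) : G ⧸ H i).out : P.V ⟶ P.V) := by
    rw [← hP.comp_rho_mul, ← hz, action_rho_one, Category.comp_id]
  have := action_rho_isIso (Q i) z
  have : IsIso ((Q i).ρ z : (Q i).V ⟶ (Q i).V).left :=
    inferInstanceAs (IsIso ((Over.forget S).map ((Q i).ρ z : (Q i).V ⟶ (Q i).V)))
  rw [h1, Over.comp_left]
  exact IsOpenImmersion.comp _ _

lemma exists_lift {κ : Over S} (hκ : IsOnePoint κ) (p : κ ⟶ P.V) :
    ∃ (i : I) (x : G) (q : κ ⟶ (Q i).V), q ≫ j i ≫ (P.ρ x : P.V ⟶ P.V) = p := by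
  obtain ⟨k, q, hq⟩ := hκ.exists_lift_of_isColimit hP.isColimit.some p
  exact ⟨k.1, k.2.out, q, hq⟩

lemma eq_of_comp_eq {κ : Over S} (hκ : IsOnePoint κ) {i i' : I} {x x' : G} (q : κ ⟶ (Q i).V)
    (q' : κ ⟶ (Q i').V)
    (h : q ≫ j i ≫ (P.ρ x : P.V ⟶ P.V) = q' ≫ j i' ≫ (P.ρ x' : P.V ⟶ P.V)) :
    (⟨i, x⟩ : Σ i, G ⧸ H i) = ⟨i', x'⟩ := by
  obtain ⟨z, hz⟩ := exists_out_mul (H i) x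
  obtain ⟨z', hz'⟩ := exists_out_mul (H i') x'
  rw [hz, hz', hP.comp_rho_mul, hP.comp_rho_mul, ← Category.assoc, ← Category.assoc q'] at h
  exact hκ.eq_of_isColimit hP.isColimit.some (j := ⟨i, x⟩) (j' := ⟨i', x'⟩) _ _ h

/-- Disjointness of the translates puts `x` and `x'` in the same coset; then `x q = x' q' = x (z
q')`, and `x` and `j i` can be cancelled. -/
lemma exists_eq_of_comp_eq {κ : Over S} (hκ : IsOnePoint κ) {i : I} {x x' : G} (q : κ ⟶ (Q i).V)
    (q' : κ ⟶ (Q i).V)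
    (h : q ≫ j i ≫ (P.ρ x : P.V ⟶ P.V) = q' ≫ j i ≫ (P.ρ x' : P.V ⟶ P.V)) :
    ∃ z : H i, x' = x * z ∧ q = q' ≫ ((Q i).ρ z : (Q i).V ⟶ (Q i).V) := by
  have h1 := hP.eq_of_comp_eq hκ q q' h
  have h2 : (x : G ⧸ H i) = x' := by simpa using h1
  let z : H i := ⟨x⁻¹ * x', QuotientGroup.eq.mp h2⟩
  have hz : x' = x * z := by simp [z]
  refine ⟨z, hz, ?_⟩
  have := hP.isOpenImmersion i
  have := over_mono (j i)
  have := action_rho_isIso P x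
  have : Mono (j i ≫ (P.ρ x : P.V ⟶ P.V)) := mono_comp _ _
  rw [← cancel_mono (j i ≫ (P.ρ x : P.V ⟶ P.V)), h, hz, hP.comp_rho_mul, Category.assoc]

end IsInduced

end InducedPoints

lemma isPullback_of_exists {𝒞 : Type u₁} [Category.{v₁} 𝒞] {A B C D : 𝒞} {f : A ⟶ B} {g : A ⟶ C}
    {h : B ⟶ D} {k : C ⟶ D} (w : f ≫ h = g ≫ k)
    (hex : ∀ (T : 𝒞) (s : T ⟶ B) (t : T ⟶ C), s ≫ h = t ≫ k → ∃ l : T ⟶ A, l ≫ f = s ∧ l ≫ g = t)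
    (huniq : ∀ (T : 𝒞) (l l' : T ⟶ A), l ≫ f = l' ≫ f → l ≫ g = l' ≫ g → l = l') :
    IsPullback f g h k := by
  choose L hL hL' using hex
  exact ⟨⟨w⟩, ⟨PullbackCone.IsLimit.mk w (fun s => L _ s.fst s.snd s.condition)
    (fun s => hL _ _ _ _) (fun s => hL' _ _ _ _)
    (fun s m hm hm' => huniq _ _ _ (hm.trans (hL _ _ _ _).symm) (hm'.trans (hL' _ _ _ _).symm))⟩⟩

/-! ### The loci where an automorphism of a torsor is given by a group element. -/

section FixedFamily

variable {S : Scheme.{u}} {G : Type w} [Group G] {Conj : Set G}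

lemma exists_conj (hConj : Set.BijOn ConjClasses.mk Conj Set.univ) (h : G) :
    ∃ (g : Conj) (x : G), h = x * g * x⁻¹ := by
  obtain ⟨g, hg, e⟩ := hConj.surjOn (Set.mem_univ (ConjClasses.mk h))
  obtain ⟨x, hx⟩ := isConj_iff.mp (ConjClasses.mk_eq_mk_iff_isConj.mp e)
  exact ⟨⟨g, hg⟩, x, hx.symm⟩

lemma eq_of_conj_eq (hConj : Set.BijOn ConjClasses.mk Conj Set.univ) {g g' : Conj} {x x' : G}
    (h : x * g * x⁻¹ = x' * g' * x'⁻¹) : g = g' := by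
  refine Subtype.ext (hConj.injOn g.2 g'.2 (ConjClasses.mk_eq_mk_iff_isConj.mpr ?_))
  refine isConj_iff.mpr ⟨x'⁻¹ * x, ?_⟩
  calc x'⁻¹ * x * g * (x'⁻¹ * x)⁻¹ = x'⁻¹ * (x * g * x⁻¹) * x' := by group
    _ = g' := by rw [h]; group

lemma mem_centralizer_of_conj_eq {g x x' : G} (h : x * g * x⁻¹ = x' * g * x'⁻¹) :
    x⁻¹ * x' ∈ Subgroup.centralizer ({g} : Set G) := by
  rw [Subgroup.mem_centralizer_singleton_iff]
  calc x⁻¹ * x' * g = x⁻¹ * (x' * g * x'⁻¹) * x' := by group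
    _ = g * (x⁻¹ * x') := by rw [← h]; group

/-- The pieces `Q g` of a `G`-scheme `P` with an endomorphism `α`, for `g` in the set `Conj`: the
loci in `P` where `α` is given by the action of `g`. -/
structure IsFixedFamily (P : Action (Over S) G) (α : P ⟶ P)
    (Q : ∀ g : Conj, Action (Over S) (Subgroup.centralizer ({(g : G)} : Set G)))
    (j : ∀ g, (Q g).V ⟶ P.V) : Prop where
  equivariant : ∀ (g : Conj) (h : Subgroup.centralizer ({(g : G)} : Set G)),
    ((Q g).ρ h : (Q g).V ⟶ (Q g).V) ≫ j g = j g ≫ (P.ρ (h : G) : P.V ⟶ P.V)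
  comp_aut : ∀ g, j g ≫ α.hom = j g ≫ (P.ρ (g : G) : P.V ⟶ P.V)
  mono : ∀ g, Mono (j g)
  exists_lift : ∀ (g : Conj) (T : Over S) (t : T ⟶ P.V),
    t ≫ α.hom = t ≫ (P.ρ (g : G) : P.V ⟶ P.V) → ∃ l : T ⟶ (Q g).V, l ≫ j g = t

namespace IsFixedFamily

variable {P : Action (Over S) G} {α : P ⟶ P}
  {Q : ∀ g : Conj, Action (Over S) (Subgroup.centralizer ({(g : G)} : Set G))}
  {j : ∀ g, (Q g).V ⟶ P.V} {U : Over S} {π : P.V ⟶ U}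

/-- `Q g` is the intersection in `P ×_U P` of the graphs of `α` and of `g`, and the graph of `g` is
open because `P` is a torsor. -/
lemma isOpenImmersion [Finite G] (h : IsFixedFamily P α Q j) (hπ : IsTorsor P π)
    (hα : α.hom ≫ π = π) (g : Conj) : IsOpenImmersion (j g).left := by
  have H : IsPullback (j g) (j g)
      (pullback.lift (𝟙 P.V) (P.ρ (g : G) : P.V ⟶ P.V) (by rw [hπ.invariant, Category.id_comp]))
      (pullback.lift (f := π) (g := π) (𝟙 P.V) α.hom (by rw [hα, Category.id_comp])) := by
    refine isPullback_of_exists ?_ (fun T s t hst => ?_) fun T l l' hl _ => ?_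
    · apply pullback.hom_ext
      · simp only [Category.assoc, pullback.lift_fst]
      · simp only [Category.assoc, pullback.lift_snd, h.comp_aut]
    · have h1 := congrArg (· ≫ pullback.fst π π) hst
      have h2 := congrArg (· ≫ pullback.snd π π) hst
      simp only [Category.assoc, pullback.lift_fst, pullback.lift_snd, Category.comp_id] at h1 h2
      subst h1
      obtain ⟨l, hl⟩ := h.exists_lift g T s h2.symm
      exact ⟨l, hl, hl⟩
    · have := h.mono g
      exact (cancel_mono (j g)).mp hl
  exact isOpenImmersion_of_isPullback H (isOpenImmersion_of_isColimit hπ.simplyTransitive.some _)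

/-- `α (x q) = x (α q) = x (g q) = (x g x⁻¹) (x q)`. -/
lemma comp_rho_aut (h : IsFixedFamily P α Q j) (g : Conj) (x : G) :
    j g ≫ (P.ρ x : P.V ⟶ P.V) ≫ α.hom =
      (j g ≫ (P.ρ x : P.V ⟶ P.V)) ≫ (P.ρ (x * g * x⁻¹) : P.V ⟶ P.V) := by
  rw [α.comm, ← Category.assoc, h.comp_aut, Category.assoc, Category.assoc, action_rho_mul,
    action_rho_mul]
  exact congrArg (fun y => j g ≫ (P.ρ y : P.V ⟶ P.V)) (by group)

/-- At the point `p` the automorphism is some `k = x g x⁻¹`, hence it is `g` at `x⁻¹ p`, which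
therefore lies in `Q g`. -/
lemma exists_point [Finite G] (h : IsFixedFamily P α Q j) (hπ : IsTorsor P π)
    (hα : α.hom ≫ π = π) (hConj : Set.BijOn ConjClasses.mk Conj Set.univ)
    {κ : Over S} (hκ : IsOnePoint κ) (p : κ ⟶ P.V) :
    ∃ (g : Conj) (x : G) (q : κ ⟶ (Q g).V), q ≫ j g ≫ (P.ρ x : P.V ⟶ P.V) = p := by
  obtain ⟨k, hk⟩ := hπ.exists_rho hκ p (p ≫ α.hom) (by rw [Category.assoc, hα])
  obtain ⟨g, x, rfl⟩ := exists_conj hConj k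
  obtain ⟨q, hq⟩ := h.exists_lift g κ (p ≫ (P.ρ x⁻¹ : P.V ⟶ P.V)) (by
    rw [Category.assoc, α.comm, ← Category.assoc, hk, Category.assoc, action_rho_mul,
      Category.assoc, action_rho_mul]
    exact congrArg (fun y => p ≫ (P.ρ y : P.V ⟶ P.V)) (by group))
  refine ⟨g, x, q, ?_⟩
  rw [← Category.assoc, hq, Category.assoc, action_rho_mul, mul_inv_cancel, action_rho_one,
    Category.comp_id]

lemma conj_eq_of_comp_eq [Finite G] (h : IsFixedFamily P α Q j) (hπ : IsTorsor P π)
    {κ : Over S} (hκ : IsOnePoint κ) {g g' : Conj} {x x' : G} (q : κ ⟶ (Q g).V)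
    (q' : κ ⟶ (Q g').V)
    (hq : q ≫ j g ≫ (P.ρ x : P.V ⟶ P.V) = q' ≫ j g' ≫ (P.ρ x' : P.V ⟶ P.V)) :
    x * (g : G) * x⁻¹ = x' * (g' : G) * x'⁻¹ := by
  refine hπ.eq_of_comp_rho hκ (q ≫ j g ≫ (P.ρ x : P.V ⟶ P.V)) ?_
  rw [Category.assoc, ← h.comp_rho_aut, hq, Category.assoc, ← h.comp_rho_aut]
  have := congrArg (· ≫ α.hom) hq
  simpa only [Category.assoc] using this

/-- The pairs `(g, x C(g))` enumerate `G` through `x g x⁻¹`, so the value of `α` at a point singles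
out the one translate containing it. -/
lemma isInduced [Finite G] (h : IsFixedFamily P α Q j) (hπ : IsTorsor P π)
    (hα : α.hom ≫ π = π) (hConj : Set.BijOn ConjClasses.mk Conj Set.univ) :
    IsInduced P Q j := by
  refine ⟨h.equivariant, nonempty_isColimit_cofan (fun k => ?_) (fun κ p hκ => ?_)
    fun κ k k' q q' hκ hq => ?_⟩
  · have := h.isOpenImmersion hπ hα k.1
    have := action_rho_isIso P k.2.out
    have : IsIso (P.ρ k.2.out : P.V ⟶ P.V).left :=
      inferInstanceAs (IsIso ((Over.forget S).map (P.ρ k.2.out : P.V ⟶ P.V)))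
    rw [Over.comp_left]
    exact IsOpenImmersion.comp _ _
  · obtain ⟨g, x, q, hq⟩ := h.exists_point hπ hα hConj hκ p
    obtain ⟨z, hz⟩ := IsInduced.exists_out_mul (Subgroup.centralizer ({(g : G)} : Set G)) x
    refine ⟨⟨g, x⟩, q ≫ ((Q g).ρ z : (Q g).V ⟶ (Q g).V), ?_⟩
    rw [← hq]
    conv_rhs => rw [hz]
    rw [← action_rho_mul, Category.assoc]
    congr 1
    rw [← Category.assoc, h.equivariant, Category.assoc]
  · have h1 := h.conj_eq_of_comp_eq hπ hκ q q' hq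
    obtain ⟨g, c⟩ := k
    obtain ⟨g', c'⟩ := k'
    obtain rfl := eq_of_conj_eq hConj h1
    have h2 := QuotientGroup.eq.mpr (mem_centralizer_of_conj_eq h1)
    rw [QuotientGroup.out_eq', QuotientGroup.out_eq'] at h2
    exact congrArg (Sigma.mk g) h2

end IsFixedFamily

end FixedFamily

/-! ### Torsors underlying the objects and morphisms of the two stacks. -/

section Views

variable {S : Scheme.{u}} {G : Type w} [Group G] {Z : Action (Over S) G} {Conj : Set G}

/-- The torsor underlying an object of `I([Z/G])`. -/
def torsor (a : InertiaObj (quotientStack Z)) : QuotientObj Z := a.ξ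

/-- The automorphism of the torsor which is part of an object of `I([Z/G])`. -/
def aut (a : InertiaObj (quotientStack Z)) : (torsor a).P ⟶ (torsor a).P :=
  QuotientHom.ψ a.α.hom

lemma aut_π (a : InertiaObj (quotientStack Z)) : (aut a).hom ≫ (torsor a).π = (torsor a).π := by
  have h : QuotientHom.φ a.α.hom = 𝟙 (torsor a).U := a.vertical
  exact (QuotientHom.isPullback a.α.hom).w.trans ((congrArg _ h).trans (Category.comp_id _))

lemma aut_toZ (a : InertiaObj (quotientStack Z)) : aut a ≫ (torsor a).toZ = (torsor a).toZ :=
  QuotientHom.comm a.α.hom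

/-- The morphism of torsors underlying a morphism of `I([Z/G])`. -/
def torsorHom {a a' : InertiaObj (quotientStack Z)} (F : a ⟶ a') :
    QuotientHom (torsor a) (torsor a') := InertiaHom.γ F

lemma aut_torsorHom {a a' : InertiaObj (quotientStack Z)} (F : a ⟶ a') :
    aut a ≫ (torsorHom F).ψ = (torsorHom F).ψ ≫ aut a' :=
  congrArg QuotientHom.ψ (InertiaHom.comm F)

lemma torsorHom_ext {a a' : InertiaObj (quotientStack Z)} {F F' : a ⟶ a'}
    (h : (torsorHom F).φ = (torsorHom F').φ) (h' : (torsorHom F).ψ = (torsorHom F').ψ) : F = F' :=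
  InertiaHom.ext (QuotientHom.ext h h')

/-- Commutation need only be required on total spaces: on the bases both automorphisms are
identities. -/
lemma exists_torsorHom_eq {a a' : InertiaObj (quotientStack Z)}
    (F : QuotientHom (torsor a) (torsor a')) (h : aut a ≫ F.ψ = F.ψ ≫ aut a') :
    ∃ F' : a ⟶ a', torsorHom F' = F := by
  refine ⟨⟨F, QuotientHom.ext ?_ h⟩, rfl⟩
  have e : QuotientHom.φ a.α.hom = 𝟙 (torsor a).U := a.vertical
  have e' : QuotientHom.φ a'.α.hom = 𝟙 (torsor a').U := a'.vertical
  exact ((congrArg (· ≫ F.φ) e).trans (Category.id_comp _)).trans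
    ((congrArg (F.φ ≫ ·) e').trans (Category.comp_id _)).symm

variable (Z Conj) in
/-- The disjoint union of the quotient stacks of the fixed loci. -/
abbrev Sectors : Type (max (u + 1) w) :=
  DisjointUnionObj fun g : Conj => quotientStack (fixedLocus Z (g : G))

/-- The torsors underlying an object of the disjoint union of the stacks `[Z^g/C(g)]`. -/
def piece (y : Sectors Z Conj) (g : Conj) : QuotientObj (fixedLocus Z (g : G)) := y.x g

/-- The inclusions of the pieces of the base. -/
def incl (y : Sectors Z Conj) (g : Conj) : (piece y g).U ⟶ y.U := y.ι g

lemma isColimit_incl (y : Sectors Z Conj) : Nonempty (IsColimit (Cofan.mk y.U (incl y))) :=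
  y.isColimit

/-- The morphisms of torsors underlying a morphism of the disjoint union. -/
def pieceHom {y y' : Sectors Z Conj} (f : y ⟶ y') (g : Conj) :
    QuotientHom (piece y g) (piece y' g) := DisjointUnionHom.h f g

/-- The morphism of the base underlying a morphism of the disjoint union. -/
def baseHom {y y' : Sectors Z Conj} (f : y ⟶ y') : y.U ⟶ y'.U := DisjointUnionHom.f f

lemma pieceHom_incl {y y' : Sectors Z Conj} (f : y ⟶ y') (g : Conj) :
    (pieceHom f g).φ ≫ incl y' g = incl y g ≫ baseHom f := DisjointUnionHom.comm f g

lemma sectors_hom_ext {y y' : Sectors Z Conj} {f f' : y ⟶ y'} (h : baseHom f = baseHom f')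
    (h' : ∀ g, pieceHom f g = pieceHom f' g) : f = f' :=
  DisjointUnionHom.ext h (funext h')

lemma exists_pieceHom_eq {y y' : Sectors Z Conj} (b : y.U ⟶ y'.U)
    (h : ∀ g, QuotientHom (piece y g) (piece y' g))
    (hh : ∀ g, (h g).φ ≫ incl y' g = incl y g ≫ b) :
    ∃ f : y ⟶ y', baseHom f = b ∧ ∀ g, pieceHom f g = h g :=
  ⟨⟨b, h, hh⟩, rfl, fun _ => rfl⟩

end Views

/-! ### Morphisms between compared objects. -/

section Comparison

variable {S : Scheme.{u}} {G : Type w} [Group G] {Z : Action (Over S) G} {Conj : Set G}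

/-- The inclusion of a fixed locus. -/
noncomputable def fixedι (Z : Action (Over S) G) (g : G) : (fixedLocus Z g).V ⟶ Z.V :=
  equalizer.ι (Z.ρ g : Z.V ⟶ Z.V) (𝟙 Z.V)

instance (Z : Action (Over S) G) (g : G) : Mono (fixedι Z g) :=
  inferInstanceAs (Mono (equalizer.ι (Z.ρ g : Z.V ⟶ Z.V) (𝟙 Z.V)))

lemma fixedι_equivariant (Z : Action (Over S) G) (g : G)
    (h : Subgroup.centralizer ({g} : Set G)) :
    ((fixedLocus Z g).ρ h : (fixedLocus Z g).V ⟶ (fixedLocus Z g).V) ≫ fixedι Z g =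
      fixedι Z g ≫ (Z.ρ (h : G) : Z.V ⟶ Z.V) :=
  equalizer.lift_ι _ _

lemma fixedι_rho (Z : Action (Over S) G) (g : G) :
    fixedι Z g ≫ (Z.ρ g : Z.V ⟶ Z.V) = fixedι Z g :=
  (equalizer.condition _ _).trans (Category.comp_id _)

lemma exists_fixedι (Z : Action (Over S) G) (g : G) {T : Over S} (t : T ⟶ Z.V)
    (ht : t ≫ (Z.ρ g : Z.V ⟶ Z.V) = t) : ∃ l : T ⟶ (fixedLocus Z g).V, l ≫ fixedι Z g = t :=
  ⟨equalizer.lift t (ht.trans (Category.comp_id _).symm), equalizer.lift_ι _ _⟩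

/-- A comparison between an object `(P, α)` of `I([Z/G])` and an object `(Q g)` of the disjoint
union of the `[Z^g/C(g)]`: an identification of the base schemes and of `Q g` with the locus of
`P` on which `α` is the action of `g`. -/
structure Comparison (a : InertiaObj (quotientStack Z)) (y : Sectors Z Conj) where
  /-- The identification of the base schemes. -/
  base : (torsor a).U ≅ y.U
  /-- The inclusions of the pieces. -/
  j : ∀ g, (piece y g).P.V ⟶ (torsor a).P.V
  comm : ∀ g, j g ≫ (torsor a).π = (piece y g).π ≫ incl y g ≫ base.inv
  toZ : ∀ g, j g ≫ (torsor a).toZ.hom = (piece y g).toZ.hom ≫ fixedι Z (g : G)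
  fixed : IsFixedFamily (torsor a).P (aut a) (fun g => (piece y g).P) j

namespace Comparison

variable {a a' : InertiaObj (quotientStack Z)} {y y' : Sectors Z Conj}

/-- The inclusions of the pieces of the base. -/
noncomputable def ι (r : Comparison a y) (g : Conj) : (piece y g).U ⟶ (torsor a).U :=
  incl y g ≫ r.base.inv

lemma isColimit_ι (r : Comparison a y) :
    Nonempty (IsColimit (Cofan.mk (torsor a).U r.ι)) :=
  ⟨IsColimit.ofIsoColimit (isColimit_incl y).some (Cofan.ext r.base.symm fun _ => rfl)⟩

lemma j_π (r : Comparison a y) (g : Conj) : r.j g ≫ (torsor a).π = (piece y g).π ≫ r.ι g :=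
  r.comm g

lemma isInduced [Finite G] (r : Comparison a y)
    (hConj : Set.BijOn ConjClasses.mk Conj Set.univ) :
    IsInduced (torsor a).P (fun g => (piece y g).P) r.j :=
  r.fixed.isInduced (torsor a).isTorsor (aut_π a) hConj

/-- Compatibility of morphisms with comparisons. -/
def Compat (r : Comparison a y) (r' : Comparison a' y') (F : a ⟶ a') (f : y ⟶ y') : Prop :=
  (torsorHom F).φ ≫ r'.base.hom = r.base.hom ≫ baseHom f ∧
    ∀ g, (pieceHom f g).ψ.hom ≫ r'.j g = r.j g ≫ (torsorHom F).ψ.hom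

variable {r : Comparison a y} {r' : Comparison a' y'}

lemma base_compat_iff (φ : (torsor a).U ⟶ (torsor a').U) (b : y.U ⟶ y'.U) :
    φ ≫ r'.base.hom = r.base.hom ≫ b ↔ b = r.base.inv ≫ φ ≫ r'.base.hom := by
  rw [Iso.eq_inv_comp, eq_comm]

lemma ι_comp_of_base {φ : (torsor a).U ⟶ (torsor a').U} {b : y.U ⟶ y'.U}
    (h : φ ≫ r'.base.hom = r.base.hom ≫ b) (g : Conj) :
    r.ι g ≫ φ = incl y g ≫ b ≫ r'.base.inv := by
  rw [ι, Category.assoc, (base_compat_iff φ b).mp h]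
  simp

lemma unique_left [Finite G] (hConj : Set.BijOn ConjClasses.mk Conj Set.univ)
    {f : y ⟶ y'} {F F' : a ⟶ a'} (h : Compat r r' F f) (h' : Compat r r' F' f) : F = F' := by
  refine torsorHom_ext ?_ ((r.isInduced hConj).action_hom_ext fun g => ?_)
  · rw [← cancel_mono r'.base.hom, h.1, h'.1]
  · rw [← h.2, h'.2]

lemma mono_ι [Finite G] (r : Comparison a y) (g : Conj) : Mono (r.ι g) :=
  have := isOpenImmersion_of_isColimit r.isColimit_ι.some g
  over_mono _

lemma unique_right [Finite G] {f f' : y ⟶ y'} {F : a ⟶ a'} (h : Compat r r' F f)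
    (h' : Compat r r' F f') : f = f' := by
  have hb : baseHom f = baseHom f' := by rw [← cancel_epi r.base.hom, ← h.1, h'.1]
  refine sectors_hom_ext hb fun g => QuotientHom.ext ?_ ?_
  · have := isOpenImmersion_of_isColimit (isColimit_incl y').some g
    have := over_mono (incl y' g)
    rw [← cancel_mono (incl y' g), pieceHom_incl, pieceHom_incl, hb]
  · ext1
    have := r'.fixed.mono g
    rw [← cancel_mono (r'.j g), h.2, h'.2]

/-- The restriction of a morphism of torsors with automorphism to the pieces. -/
lemma exists_right [Finite G] (r : Comparison a y) (r' : Comparison a' y') (F : a ⟶ a') :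
    ∃ f : y ⟶ y', Compat r r' F f := by
  have hmono (g : Conj) := r'.fixed.mono g
  have hmonoι (g : Conj) := r.mono_ι g
  have hmonoι' (g : Conj) := r'.mono_ι g
  have hψ (g : Conj) : ∃ ψ : (piece y g).P ⟶ (piece y' g).P,
      ψ.hom ≫ r'.j g = r.j g ≫ (torsorHom F).ψ.hom := by
    obtain ⟨ψ, hψ⟩ := r'.fixed.exists_lift g _ (r.j g ≫ (torsorHom F).ψ.hom) (by
      have := congrArg Action.Hom.hom (aut_torsorHom F)
      rw [Action.comp_hom, Action.comp_hom] at this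
      rw [Category.assoc, ← this, ← Category.assoc, r.fixed.comp_aut, Category.assoc,
        Category.assoc, (torsorHom F).ψ.comm])
    refine ⟨⟨ψ, fun c => ?_⟩, hψ⟩
    rw [← cancel_mono (r'.j g), Category.assoc, hψ, Category.assoc, r'.fixed.equivariant,
      ← Category.assoc, r.fixed.equivariant, ← Category.assoc, hψ, Category.assoc, Category.assoc,
      (torsorHom F).ψ.comm]
  choose ψ hψ using hψ
  -- A point of `U_g` lifts, after extension, to `Q_g`; its image in `Q'_g` lies over `U'_g`, so the
  -- base morphism sends `U_g` into `U'_g`.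
  have hφ (g : Conj) : ∃ φ : (piece y g).U ⟶ (piece y' g).U,
      φ ≫ r'.ι g = r.ι g ≫ (torsorHom F).φ := by
    have := isOpenImmersion_of_isColimit r'.isColimit_ι.some g
    refine exists_lift_of_onePoint (r'.ι g) _ fun κ s hκ => ?_
    obtain ⟨g', l, hl⟩ := hκ.exists_lift_of_isColimit r'.isColimit_ι.some
      (s ≫ r.ι g ≫ (torsorHom F).φ)
    obtain ⟨κ', c, q, hκ', hq⟩ :=
      hκ.exists_lift_of_surjective _ (piece y g).isTorsor.surjective s
    have : g' = g := by
      refine hκ'.eq_of_isColimit r'.isColimit_ι.some (c ≫ l) (q ≫ (ψ g).hom ≫ (piece y' g).π) ?_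
      rw [Category.assoc, hl, ← Category.assoc, ← hq, Category.assoc, Category.assoc,
        Category.assoc, ← r'.j_π, ← Category.assoc (ψ g).hom, hψ, Category.assoc,
        (torsorHom F).isPullback.w, ← Category.assoc (r.j g), r.j_π, Category.assoc]
    subst this
    exact ⟨l, hl⟩
  choose φ hφ using hφ
  have hw (g : Conj) : (ψ g).hom ≫ (piece y' g).π = (piece y g).π ≫ φ g := by
    rw [← cancel_mono (r'.ι g), Category.assoc, ← r'.j_π, ← Category.assoc, hψ, Category.assoc,
      (torsorHom F).isPullback.w, ← Category.assoc, r.j_π, Category.assoc, Category.assoc, hφ]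
  have hpb (g : Conj) : IsPullback (ψ g).hom (piece y g).π (piece y' g).π (φ g) := by
    refine isPullback_of_exists (hw g) (fun T s t hst => ?_) fun T l l' hl hl' => ?_
    · obtain ⟨p, hp, hp'⟩ := (torsorHom F).isPullback.exists_lift (s ≫ r'.j g) (t ≫ r.ι g) (by
        rw [Category.assoc, r'.j_π, ← Category.assoc, hst, Category.assoc, Category.assoc, hφ])
      -- To see `α p = g p`, use the cartesian square: the images in the target torsor agree because
      -- `s` lands in `Q'_g`, and the projections to the base agree by invariance.
      obtain ⟨q, hq⟩ := r.fixed.exists_lift g T p (by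
        refine (torsorHom F).isPullback.hom_ext ?_ ?_
        · have := congrArg Action.Hom.hom (aut_torsorHom F)
          rw [Action.comp_hom, Action.comp_hom] at this
          rw [Category.assoc, this, Category.assoc, (torsorHom F).ψ.comm, ← Category.assoc, hp,
            ← Category.assoc, hp, Category.assoc, Category.assoc, r'.fixed.comp_aut]
        · rw [Category.assoc, Category.assoc, aut_π, (torsor a).isTorsor.invariant])
      refine ⟨q, ?_, ?_⟩
      · rw [← cancel_mono (r'.j g), Category.assoc, hψ, ← Category.assoc, hq, hp]
      · rw [← cancel_mono (r.ι g), Category.assoc, ← r.j_π, ← Category.assoc, hq, hp']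
    · have := r.fixed.mono g
      rw [← cancel_mono (r.j g)]
      refine (torsorHom F).isPullback.hom_ext ?_ ?_
      · rw [Category.assoc, Category.assoc, ← hψ, ← Category.assoc, hl, Category.assoc]
      · rw [Category.assoc, Category.assoc, r.j_π, ← Category.assoc, hl', Category.assoc]
  have hZ (g : Conj) : ψ g ≫ (piece y' g).toZ = (piece y g).toZ := by
    ext1
    rw [Action.comp_hom, ← cancel_mono (fixedι Z (g : G)), Category.assoc, ← r'.toZ,
      ← Category.assoc, hψ, Category.assoc, ← Action.comp_hom, (torsorHom F).comm, r.toZ]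
  have hb : (torsorHom F).φ ≫ r'.base.hom =
      r.base.hom ≫ r.base.inv ≫ (torsorHom F).φ ≫ r'.base.hom := by simp
  obtain ⟨f, hf, hf'⟩ := exists_pieceHom_eq (r.base.inv ≫ (torsorHom F).φ ≫ r'.base.hom)
    (fun g => ⟨φ g, ψ g, hpb g, hZ g⟩) (fun g => by
      have := hφ g
      rw [ι_comp_of_base hb, ι, ← Category.assoc, ← Category.assoc, cancel_mono] at this
      exact this)
  refine ⟨f, by rw [hf, ← hb], fun g => ?_⟩
  rw [hf']
  exact hψ g

/-- The base change of a piece of a torsor along a morphism of the base. -/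
lemma isPullback_piece [Finite G] (f : y ⟶ y') {φ : (torsor a).U ⟶ (torsor a').U}
    (hφ : φ ≫ r'.base.hom = r.base.hom ≫ baseHom f) (g : Conj) :
    IsPullback (pieceHom f g).ψ.hom ((piece y g).π ≫ r.ι g) ((piece y' g).π ≫ r'.ι g) φ := by
  have hmonoι := r.mono_ι g
  have hmonoι' := r'.mono_ι g
  have hι (g : Conj) : r.ι g ≫ φ = (pieceHom f g).φ ≫ r'.ι g := by
    rw [ι_comp_of_base hφ, ← Category.assoc, ← pieceHom_incl, Category.assoc]
    rfl
  refine isPullback_of_exists ?_ (fun T s t hst => ?_) fun T l l' hl hl' => ?_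
  · rw [← Category.assoc, (pieceHom f g).isPullback.w, Category.assoc, Category.assoc, hι]
  · have := isOpenImmersion_of_isColimit r.isColimit_ι.some g
    -- The preimage of `U'_g` in the whole base is just `U_g`, since each other piece maps to its
    -- own counterpart.
    obtain ⟨l, hl⟩ := exists_lift_of_onePoint (r.ι g) t fun κ c hκ => by
      obtain ⟨g', l, hl⟩ := hκ.exists_lift_of_isColimit r.isColimit_ι.some (c ≫ t)
      have : g' = g := by
        refine hκ.eq_of_isColimit r'.isColimit_ι.some (l ≫ (pieceHom f g').φ)
          (c ≫ s ≫ (piece y' g).π) ?_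
        rw [Category.assoc, ← hι, ← Category.assoc, hl, Category.assoc, ← hst, Category.assoc,
          Category.assoc]
      subst this
      exact ⟨l, hl⟩
    obtain ⟨q, hq, hq'⟩ := (pieceHom f g).isPullback.exists_lift s l (by
      rw [← cancel_mono (r'.ι g), Category.assoc, hst, Category.assoc, ← hι, ← Category.assoc, hl])
    exact ⟨q, hq, by rw [← Category.assoc, hq', hl]⟩
  · refine (pieceHom f g).isPullback.hom_ext hl ?_
    rw [← cancel_mono (r.ι g), Category.assoc, Category.assoc, hl']

/-- The extension of morphisms of the pieces to the torsors. -/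
lemma exists_left [Finite G] (hConj : Set.BijOn ConjClasses.mk Conj Set.univ)
    (r : Comparison a y) (r' : Comparison a' y') (f : y ⟶ y') :
    ∃ F : a ⟶ a', Compat r r' F f := by
  have hP := r.isInduced hConj
  have hP' := r'.isInduced hConj
  obtain ⟨φ, hφ⟩ : ∃ φ : (torsor a).U ⟶ (torsor a').U,
      φ ≫ r'.base.hom = r.base.hom ≫ baseHom f :=
    ⟨r.base.hom ≫ baseHom f ≫ r'.base.inv, by simp⟩
  obtain ⟨ψ, hψ⟩ := hP.exists_desc (torsor a').P (fun g => (pieceHom f g).ψ.hom ≫ r'.j g)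
    (fun g c => by
      rw [← Category.assoc, (pieceHom f g).ψ.comm, Category.assoc, r'.fixed.equivariant,
        Category.assoc])
  have hpb (g : Conj) := isPullback_piece (r := r) (r' := r') f hφ g
  have hw : ψ.hom ≫ (torsor a').π = (torsor a).π ≫ φ := by
    refine hP.hom_ext fun g x => ?_
    rw [← Category.assoc ((torsor a).P.ρ x : (torsor a).P.V ⟶ (torsor a).P.V), ψ.comm,
      Category.assoc, (torsor a').isTorsor.invariant, ← Category.assoc, hψ, Category.assoc,
      r'.j_π, (hpb g).w, ← r.j_π, Category.assoc,
      ← Category.assoc ((torsor a).P.ρ x : (torsor a).P.V ⟶ (torsor a).P.V) (torsor a).π,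
      (torsor a).isTorsor.invariant]
  have hZ : ψ ≫ (torsor a').toZ = (torsor a).toZ := by
    refine hP.action_hom_ext fun g => ?_
    rw [Action.comp_hom, ← Category.assoc, hψ, Category.assoc, r'.toZ, ← Category.assoc,
      ← Action.comp_hom, (pieceHom f g).comm, r.toZ]
  have hα : aut a ≫ ψ = ψ ≫ aut a' := by
    refine hP.action_hom_ext fun g => ?_
    rw [Action.comp_hom, Action.comp_hom, ← Category.assoc, r.fixed.comp_aut, Category.assoc,
      ψ.comm, ← Category.assoc, hψ, ← Category.assoc, hψ, Category.assoc, Category.assoc,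
      r'.fixed.comp_aut]
  -- It remains to show that the square is cartesian. The fibre product `A` is decomposed by pulling
  -- back the translates of the pieces of the target torsor, and `δ` is then a comparison of two
  -- coproducts of the same pieces.
  let A := pullback (torsor a').π φ
  let δ : (torsor a).P.V ⟶ A := pullback.lift ψ.hom (torsor a).π hw
  let t (k : Σ g : Conj, G ⧸ Subgroup.centralizer ({(g : G)} : Set G)) :
      (piece y k.1).P.V ⟶ A :=
    (r.j k.1 ≫ ((torsor a).P.ρ k.2.out : (torsor a).P.V ⟶ (torsor a).P.V)) ≫ δ
  have ht (k) : t k ≫ pullback.fst _ _ = (pieceHom f k.1).ψ.hom ≫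
      r'.j k.1 ≫ ((torsor a').P.ρ k.2.out : (torsor a').P.V ⟶ (torsor a').P.V) := by
    rw [Category.assoc, pullback.lift_fst, Category.assoc, ψ.comm, ← Category.assoc, hψ,
      Category.assoc]
  have ht' (k) : t k ≫ pullback.snd _ _ = (piece y k.1).π ≫ r.ι k.1 := by
    rw [Category.assoc, pullback.lift_snd, Category.assoc, (torsor a).isTorsor.invariant, r.j_π]
  -- Translation does not change the projection to the base, so this reduces to `isPullback_piece`.
  have hsq (k) : IsPullback (pieceHom f k.1).ψ.hom (t k)
      (r'.j k.1 ≫ ((torsor a').P.ρ k.2.out : (torsor a').P.V ⟶ (torsor a').P.V))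
      (pullback.fst (torsor a').π φ) := by
    refine isPullback_of_exists (ht k).symm (fun T q' p hp => ?_) fun T l l' hl hl' => ?_
    · obtain ⟨q, hq, hq'⟩ := (hpb k.1).exists_lift q' (p ≫ pullback.snd _ _) (by
        rw [Category.assoc, ← pullback.condition, ← Category.assoc p, ← hp, Category.assoc,
          Category.assoc, (torsor a').isTorsor.invariant, r'.j_π])
      refine ⟨q, hq, ?_⟩
      apply pullback.hom_ext
      · rw [Category.assoc, ht, ← Category.assoc, hq, hp]
      · rw [Category.assoc, ht', hq']
    · refine (hpb k.1).hom_ext hl ?_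
      rw [← ht', ← Category.assoc, hl', Category.assoc]
  have hcol : Nonempty (IsColimit (Cofan.mk A t)) := by
    refine nonempty_isColimit_cofan (fun k => isOpenImmersion_of_isPullback (hsq k)
      (isOpenImmersion_of_isColimit hP'.isColimit.some k)) (fun κ p hκ => ?_)
      fun κ k k' l l' hκ hl => ?_
    · obtain ⟨k, q, hq⟩ := hκ.exists_lift_of_isColimit hP'.isColimit.some
        (p ≫ pullback.fst _ _)
      obtain ⟨q', -, hq'⟩ := (hsq k).exists_lift q p hq
      exact ⟨k, q', hq'⟩
    · refine hκ.eq_of_isColimit hP'.isColimit.some (l ≫ (pieceHom f k.1).ψ.hom)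
        (l' ≫ (pieceHom f k'.1).ψ.hom) ?_
      rw [Category.assoc, Category.assoc, ← ht, ← ht, ← Category.assoc, hl, Category.assoc]
  have hδ : IsIso δ := by
    have : δ = (hP.isColimit.some.coconePointUniqueUpToIso hcol.some).hom := by
      refine Cofan.IsColimit.hom_ext hP.isColimit.some _ _ fun k => ?_
      exact (hP.isColimit.some.comp_coconePointUniqueUpToIso_hom hcol.some ⟨k⟩).symm
    rw [this]
    infer_instance
  have hpull : IsPullback ψ.hom (torsor a).π (torsor a').π φ :=
    IsPullback.of_iso_pullback ⟨hw⟩ (asIso δ) (pullback.lift_fst _ _ _) (pullback.lift_snd _ _ _)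
  obtain ⟨F, hF⟩ := exists_torsorHom_eq ⟨φ, ψ, hpull, hZ⟩ hα
  refine ⟨F, ?_, fun g => ?_⟩
  · rw [hF]
    exact hφ
  · rw [hF]
    exact (hψ g).symm

end Comparison

end Comparison

/-! ### Objects: decomposing and inducing torsors. -/

section Objects

variable {S : Scheme.{u}} {G : Type w} [Group G] {Z : Action (Over S) G} {Conj : Set G}

/-- The object of `I([Z/G])` which consists of an object of `[Z/G]` and an automorphism of the
underlying torsor. -/
def inertiaObjMk (X : QuotientObj Z) (α : X.P ≅ X.P) (hπ : α.hom.hom ≫ X.π = X.π)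
    (hZ : α.hom ≫ X.toZ = X.toZ) : InertiaObj (quotientStack Z) :=
  have h : α.hom.hom ≫ α.inv.hom = 𝟙 _ := congrArg Action.Hom.hom α.hom_inv_id
  have h' : α.inv.hom ≫ α.hom.hom = 𝟙 _ := congrArg Action.Hom.hom α.inv_hom_id
  have : IsIso α.hom.hom := ⟨α.inv.hom, h, h'⟩
  have : IsIso α.inv.hom := ⟨α.hom.hom, h', h⟩
  have hπ' : α.inv.hom ≫ X.π = X.π := by
    conv_lhs => rw [← hπ, ← Category.assoc, h', Category.id_comp]
  let F : QuotientHom X X := ⟨𝟙 _, α.hom,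
    IsPullback.of_horiz_isIso ⟨hπ.trans (Category.comp_id _).symm⟩, hZ⟩
  let F' : QuotientHom X X := ⟨𝟙 _, α.inv,
    IsPullback.of_horiz_isIso ⟨hπ'.trans (Category.comp_id _).symm⟩,
    (Iso.inv_comp_eq α).mpr hZ.symm⟩
  ⟨X, ⟨F, F', QuotientHom.ext (Category.comp_id _) α.hom_inv_id,
    QuotientHom.ext (Category.comp_id _) α.inv_hom_id⟩, rfl⟩

/-- The locus in `P` where `α` is the action of `g`, with the action of the centralizer. -/
noncomputable def fixedPiece (P : Action (Over S) G) (α : P ⟶ P) (g : G) :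
    Action (Over S) (Subgroup.centralizer ({g} : Set G)) where
  V := equalizer α.hom (P.ρ g : P.V ⟶ P.V)
  ρ :=
    { toFun := fun h => equalizer.lift
        (equalizer.ι α.hom (P.ρ g : P.V ⟶ P.V) ≫ (P.ρ (h : G) : P.V ⟶ P.V)) (by
          have hc : (h : G) * g = g * h := Subgroup.mem_centralizer_singleton_iff.mp h.2
          rw [Category.assoc, α.comm, ← Category.assoc, equalizer.condition, Category.assoc,
            Category.assoc, action_rho_mul, action_rho_mul, hc])
      map_one' := by
        apply equalizer.hom_ext
        rw [equalizer.lift_ι, Subgroup.coe_one, action_rho_one]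
        exact (Category.comp_id _).trans (Category.id_comp _).symm
      map_mul' := fun h k => by
        apply equalizer.hom_ext
        rw [equalizer.lift_ι, Subgroup.coe_mul, End.mul_def, Category.assoc, equalizer.lift_ι,
          ← Category.assoc, equalizer.lift_ι, Category.assoc, action_rho_mul] }

/-- The inclusion of the locus where `α` is the action of `g`. -/
noncomputable def fixedPieceι (P : Action (Over S) G) (α : P ⟶ P) (g : G) :
    (fixedPiece P α g).V ⟶ P.V :=
  equalizer.ι α.hom (P.ρ g : P.V ⟶ P.V)

lemma isFixedFamily_fixedPiece (P : Action (Over S) G) (α : P ⟶ P) (Conj : Set G) :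
    IsFixedFamily P α (fun g : Conj => fixedPiece P α (g : G)) (fun g => fixedPieceι P α (g : G)) :=
  ⟨fun _ _ => equalizer.lift_ι _ _, fun _ => equalizer.condition _ _,
    fun g => inferInstanceAs (Mono (equalizer.ι α.hom (P.ρ (g : G) : P.V ⟶ P.V))),
    fun _ _ t ht => ⟨equalizer.lift t ht, equalizer.lift_ι _ _⟩⟩

variable [Finite G]

/-- Points `x q` and `x' q'` with the same image lie over one piece `U_g`, where `q' = z q` with `z`
in `C(g)`; thus `x' z x⁻¹` carries the first to the second. Freeness reduces in the same way to that
of the `C(g)`-action. -/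
lemma isTorsor_of_isInduced (y : Sectors Z Conj) {P : Action (Over S) G}
    {j : ∀ g, (piece y g).P.V ⟶ P.V} (hP : IsInduced P (fun g => (piece y g).P) j)
    {π : P.V ⟶ y.U} (hinv : ∀ x : G, (P.ρ x : P.V ⟶ P.V) ≫ π = π)
    (hπ : ∀ g, j g ≫ π = (piece y g).π ≫ incl y g) : IsTorsor P π := by
  have hopen (g : Conj) : IsOpenImmersion (incl y g).left :=
    isOpenImmersion_of_isColimit (isColimit_incl y).some g
  have hmono (g : Conj) : Mono (incl y g) := over_mono (incl y g)
  refine isTorsor_of_onePoint P π hinv ?_ ?_ (fun κ p p' hκ hp => ?_) fun κ p x x' hκ hp => ?_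
  · refine etale_of_isColimit hP.isColimit.some π fun k => ?_
    have := (piece y k.1).isTorsor.etale
    rw [Category.assoc, hinv, hπ, Over.comp_left]
    infer_instance
  · refine ⟨fun u => ?_⟩
    obtain ⟨g, v, rfl⟩ := exists_eq_of_isColimit (isColimit_incl y).some u
    obtain ⟨q, rfl⟩ := (piece y g).isTorsor.surjective.surj v
    refine ⟨(j g).left q, ?_⟩
    rw [← comp_left_apply, hπ, comp_left_apply]
  · obtain ⟨g, x, q, rfl⟩ := hP.exists_lift hκ p
    obtain ⟨g', x', q', rfl⟩ := hP.exists_lift hκ p'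
    rw [Category.assoc, Category.assoc, hinv, hπ, Category.assoc, Category.assoc, hinv, hπ] at hp
    obtain rfl : g = g' := by
      refine hκ.eq_of_isColimit (isColimit_incl y).some (q ≫ (piece y g).π)
        (q' ≫ (piece y g').π) ?_
      rw [Category.assoc, Category.assoc, hp]
    obtain ⟨z, hz⟩ := (piece y g).isTorsor.exists_rho hκ q q' (by
      rw [← cancel_mono (incl y g), Category.assoc, Category.assoc, hp])
    refine ⟨x' * z * x⁻¹, ?_⟩
    rw [Category.assoc, Category.assoc, action_rho_mul, inv_mul_cancel_right,
      hP.comp_rho_mul, hz, Category.assoc]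
  · obtain ⟨g, y', q, rfl⟩ := hP.exists_lift hκ p
    rw [Category.assoc, Category.assoc, action_rho_mul, Category.assoc, Category.assoc,
      action_rho_mul] at hp
    obtain ⟨z, hz, hq⟩ := hP.exists_eq_of_comp_eq hκ q q hp
    have : z = 1 := by
      refine (piece y g).isTorsor.eq_of_comp_rho hκ q ?_
      rw [action_rho_one, Category.comp_id]
      exact hq.symm
    subst this
    simpa using hz.symm

/-- The induced action with its tautological automorphism. -/
lemma isFixedFamily_of_isInduced (hConj : Set.BijOn ConjClasses.mk Conj Set.univ)
    (y : Sectors Z Conj) {P : Action (Over S) G} {α : P ⟶ P}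
    {j : ∀ g, (piece y g).P.V ⟶ P.V} (hP : IsInduced P (fun g => (piece y g).P) j)
    (hα : ∀ g, j g ≫ α.hom = j g ≫ (P.ρ (g : G) : P.V ⟶ P.V)) :
    IsFixedFamily P α (fun g => (piece y g).P) j := by
  have hopen (g : Conj) := hP.isOpenImmersion g
  refine ⟨hP.equivariant, hα, fun g => over_mono (j g), fun g T t ht => ?_⟩
  refine exists_lift_of_onePoint (j g) t fun κ s hκ => ?_
  obtain ⟨g', x, q, hq⟩ := hP.exists_lift hκ (s ≫ t)
  -- At the point `x q` the automorphism is both `x g' x⁻¹` and `g`. Freeness gives `g x = x g'`,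
  -- hence `g = g'` and `x` lies in `C(g)`, so `x q` is already in `Q g`.
  have h1 : q ≫ j g' ≫ (P.ρ (x * g') : P.V ⟶ P.V) = q ≫ j g' ≫ (P.ρ (g * x) : P.V ⟶ P.V) := by
    have h2 : (s ≫ t) ≫ α.hom = (s ≫ t) ≫ (P.ρ (g : G) : P.V ⟶ P.V) := by
      rw [Category.assoc, ht, Category.assoc]
    rw [← hq, Category.assoc, Category.assoc, α.comm, ← Category.assoc (j g'), hα,
      Category.assoc, action_rho_mul, Category.assoc, Category.assoc, action_rho_mul] at h2
    exact h2
  obtain ⟨z, hz, hqz⟩ := hP.exists_eq_of_comp_eq hκ q q h1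
  have : z = 1 := by
    refine (piece y g').isTorsor.eq_of_comp_rho hκ q ?_
    rw [action_rho_one, Category.comp_id]
    exact hqz.symm
  subst this
  rw [Subgroup.coe_one, mul_one] at hz
  obtain rfl : g = g' := eq_of_conj_eq hConj (x := 1) (x' := x) (by
    rw [← hz, one_mul, inv_one, mul_one, mul_inv_cancel_right])
  refine ⟨q ≫ ((piece y g).P.ρ ⟨x, Subgroup.mem_centralizer_singleton_iff.mpr hz.symm⟩ :
    (piece y g).P.V ⟶ (piece y g).P.V), ?_⟩
  rw [Category.assoc, hP.equivariant, hq]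

/-- The object of `I([Z/G])` which is induced from an object of the disjoint union of the stacks
`[Z^g/C(g)]`. -/
lemma exists_comparison_left (hConj : Set.BijOn ConjClasses.mk Conj Set.univ)
    (y : Sectors Z Conj) :
    ∃ (a : InertiaObj (quotientStack Z)) (r : Comparison a y) (h : (torsor a).U = y.U),
      r.base = eqToIso h := by
  obtain ⟨P, j, hP⟩ : ∃ (P : Action (Over S) G) (j : ∀ g, (piece y g).P.V ⟶ P.V),
      IsInduced P (fun g => (piece y g).P) j :=
    ⟨_, _, isInduced_inducedAction fun g => (piece y g).P⟩
  obtain ⟨π, hinv, hπ⟩ := hP.exists_desc_invariant (fun g => (piece y g).π ≫ incl y g)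
    (fun g c => by rw [← Category.assoc, (piece y g).isTorsor.invariant])
  obtain ⟨f, hf⟩ := hP.exists_desc Z (fun g => (piece y g).toZ.hom ≫ fixedι Z (g : G))
    (fun g c => by
      rw [← Category.assoc, (piece y g).toZ.comm, Category.assoc, fixedι_equivariant,
        Category.assoc])
  have hcomm (g : Conj) (c : Subgroup.centralizer ({(g : G)} : Set G)) : (c : G) * g = g * c :=
    Subgroup.mem_centralizer_singleton_iff.mp c.2
  -- Acting by `g` on `Q g` is `C(g)`-equivariant exactly because `C(g)` commutes with `g`; its
  -- inverse `α'` is built likewise from `g⁻¹`.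
  obtain ⟨α, hα⟩ := hP.exists_desc P (fun g => j g ≫ (P.ρ (g : G) : P.V ⟶ P.V)) (fun g c => by
    rw [← Category.assoc, hP.equivariant, Category.assoc, action_rho_mul, Category.assoc,
      action_rho_mul, hcomm])
  obtain ⟨α', hα'⟩ := hP.exists_desc P (fun g => j g ≫ (P.ρ (g : G)⁻¹ : P.V ⟶ P.V))
    (fun g c => by
      have : (g : G)⁻¹ * c = c * (g : G)⁻¹ := by
        rw [inv_mul_eq_iff_eq_mul, ← mul_assoc, ← hcomm, mul_inv_cancel_right]
      rw [← Category.assoc, hP.equivariant, Category.assoc, action_rho_mul, Category.assoc,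
        action_rho_mul, this])
  have hαα' : α ≫ α' = 𝟙 P := hP.action_hom_ext fun g => by
    rw [Action.comp_hom, ← Category.assoc, hα, Category.assoc, α'.comm, ← Category.assoc, hα',
      Category.assoc, action_rho_mul, mul_inv_cancel, action_rho_one]
    rfl
  have hα'α : α' ≫ α = 𝟙 P := hP.action_hom_ext fun g => by
    rw [Action.comp_hom, ← Category.assoc, hα', Category.assoc, α.comm, ← Category.assoc, hα,
      Category.assoc, action_rho_mul, inv_mul_cancel, action_rho_one]
    rfl
  have hαπ : α.hom ≫ π = π := hP.hom_ext fun g x => by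
    rw [← Category.assoc (P.ρ x : P.V ⟶ P.V), α.comm, Category.assoc, hinv,
      ← Category.assoc, hα, Category.assoc, hinv]
  have hαf : α ≫ f = f := hP.action_hom_ext fun g => by
    rw [Action.comp_hom, ← Category.assoc, hα, Category.assoc, f.comm, ← Category.assoc, hf,
      Category.assoc, fixedι_rho]
  exact ⟨inertiaObjMk ⟨y.U, P, π, isTorsor_of_isInduced y hP hinv hπ, f⟩ ⟨α, α', hαα', hα'α⟩
    hαπ hαf,
    { base := Iso.refl y.U
      j := j
      comm := fun g => (hπ g).trans (congrArg _ (Category.comp_id _).symm)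
      toZ := hf
      fixed := isFixedFamily_of_isInduced hConj y hP hα }, rfl, rfl⟩

/-- An étale morphism factors into a surjective morphism and an open immersion. -/
lemma exists_image {X U : Over S} (f : X ⟶ U) (hf : Etale f.left) :
    ∃ (V : Over S) (p : X ⟶ V) (i : V ⟶ U), p ≫ i = f ∧ IsOpenImmersion i.left ∧
      Etale p.left ∧ Surjective p.left := by
  let W : U.left.Opens := ⟨Set.range f.left, f.left.isOpenMap.isOpen_range⟩
  let i : Over.mk (W.ι ≫ U.hom) ⟶ U := Over.homMk W.ι
  have hi : IsOpenImmersion i.left := inferInstanceAs (IsOpenImmersion W.ι)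
  obtain ⟨p, hp⟩ := exists_lift_of_range_subset i f (by
    change Set.range f.left ⊆ Set.range W.ι
    rw [Scheme.Opens.range_ι]
    exact subset_rfl)
  refine ⟨_, p, i, hp, hi, etale_of_comp_openImmersion p i (by rwa [hp]) hi, ⟨fun v => ?_⟩⟩
  have hv : i.left v ∈ Set.range f.left := by
    have : W.ι v ∈ (W : Set U.left) := by
      rw [← Scheme.Opens.range_ι]
      exact ⟨v, rfl⟩
    exact this
  obtain ⟨x, hx⟩ := hv
  refine ⟨x, i.left.isOpenEmbedding.injective ?_⟩
  rw [← comp_left_apply, hp]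
  exact hx

/-- The pieces of a torsor with an automorphism are torsors under the centralizers. -/
lemma isTorsor_piece {P : Action (Over S) G} {α : P ⟶ P} {U : Over S} {π : P.V ⟶ U}
    (hπ : IsTorsor P π)
    {Q : ∀ g : Conj, Action (Over S) (Subgroup.centralizer ({(g : G)} : Set G))}
    {j : ∀ g, (Q g).V ⟶ P.V} (h : IsFixedFamily P α Q j) (g : Conj) {V : Over S}
    {p : (Q g).V ⟶ V} {i : V ⟶ U} (hp : p ≫ i = j g ≫ π) (hi : IsOpenImmersion i.left)
    (het : Etale p.left) (hsurj : Surjective p.left) : IsTorsor (Q g) p := by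
  have := over_mono i
  have := h.mono g
  refine isTorsor_of_onePoint (Q g) p (fun c => ?_) het hsurj (fun κ q q' hκ hq => ?_)
    fun κ q x x' hκ hx => ?_
  · rw [← cancel_mono i, Category.assoc, hp, ← Category.assoc, h.equivariant, Category.assoc,
      hπ.invariant]
  · have h1 : (q ≫ j g) ≫ π = (q' ≫ j g) ≫ π := by
      rw [Category.assoc, Category.assoc, ← hp, ← Category.assoc, hq, Category.assoc]
    obtain ⟨x, hx⟩ := hπ.exists_rho hκ _ _ h1
    -- From `q = x⁻¹ q'` with both points in `Q g`, the automorphism at `q` is both `g` and `x⁻¹ g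
    -- x`, so `x` centralizes `g`.
    have h2 := h.conj_eq_of_comp_eq hπ hκ (x := 1) (x' := x⁻¹) q q' (by
      rw [action_rho_one, Category.comp_id, ← Category.assoc, hx, Category.assoc, Category.assoc,
        action_rho_mul, inv_mul_cancel, action_rho_one, Category.comp_id])
    have hxc := inv_mem (mem_centralizer_of_conj_eq h2)
    rw [inv_one, one_mul, inv_inv] at hxc
    refine ⟨⟨x, hxc⟩, ?_⟩
    rw [← cancel_mono (j g), hx, Category.assoc, Category.assoc, h.equivariant]
  · refine Subtype.ext (hπ.eq_of_comp_rho hκ (q ≫ j g) ?_)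
    rw [Category.assoc, ← h.equivariant, ← Category.assoc, hx, Category.assoc, h.equivariant,
      Category.assoc]

/-- The base of a torsor with an automorphism is the disjoint union of the images of the pieces. -/
lemma isColimit_images {P : Action (Over S) G} {α : P ⟶ P} {U : Over S} {π : P.V ⟶ U}
    (hπ : IsTorsor P π) (hα : α.hom ≫ π = π) (hConj : Set.BijOn ConjClasses.mk Conj Set.univ)
    {Q : ∀ g : Conj, Action (Over S) (Subgroup.centralizer ({(g : G)} : Set G))}
    {j : ∀ g, (Q g).V ⟶ P.V} (h : IsFixedFamily P α Q j) {V : Conj → Over S}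
    {p : ∀ g, (Q g).V ⟶ V g} {i : ∀ g, V g ⟶ U} (hp : ∀ g, p g ≫ i g = j g ≫ π)
    (hi : ∀ g, IsOpenImmersion (i g).left) (hsurj : ∀ g, Surjective (p g).left) :
    Nonempty (IsColimit (Cofan.mk U i)) := by
  refine nonempty_isColimit_cofan hi (fun κ t hκ => ?_) fun κ g g' l l' hκ hl => ?_
  · obtain ⟨κ', c, s, hκ', hs⟩ := hκ.exists_lift_of_surjective π hπ.surjective t
    obtain ⟨g, x, q, rfl⟩ := h.exists_point hπ hα hConj hκ' s
    rw [Category.assoc, Category.assoc, hπ.invariant, ← hp] at hs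
    obtain ⟨z, -⟩ := id hκ'
    refine ⟨g, hκ.exists_lift (i g) t (q := c.left z) (y := (p g).left (q.left z)) ?_⟩
    rw [← comp_left_apply, ← hs, comp_left_apply, comp_left_apply]
  · obtain ⟨κ₁, c, q, hκ₁, hq⟩ := hκ.exists_lift_of_surjective _ (hsurj g) l
    obtain ⟨κ₂, c', q', hκ₂, hq'⟩ := hκ₁.exists_lift_of_surjective _ (hsurj g') (c ≫ l')
    have h1 : ((c' ≫ q) ≫ j g) ≫ π = (q' ≫ j g') ≫ π := by
      rw [Category.assoc, ← hp, Category.assoc, ← Category.assoc q, hq, Category.assoc, hl,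
        Category.assoc, ← hp, ← Category.assoc q', hq', Category.assoc, Category.assoc]
    obtain ⟨x, hx⟩ := hπ.exists_rho hκ₂ _ _ h1
    refine eq_of_conj_eq hConj (h.conj_eq_of_comp_eq hπ hκ₂ (x := x) (x' := 1) (c' ≫ q) q' ?_)
    rw [action_rho_one, Category.comp_id, hx, Category.assoc, Category.assoc, Category.assoc]

/-- The decomposition of a torsor with an automorphism. -/
lemma exists_comparison_right (hConj : Set.BijOn ConjClasses.mk Conj Set.univ)
    (a : InertiaObj (quotientStack Z)) :
    ∃ (y : Sectors Z Conj) (r : Comparison a y) (h : (torsor a).U = y.U),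
      r.base = eqToIso h := by
  have hπ := (torsor a).isTorsor
  have hα := aut_π a
  have h := isFixedFamily_fixedPiece (torsor a).P (aut a) Conj
  have himage (g : Conj) := exists_image
    (fixedPieceι (torsor a).P (aut a) (g : G) ≫ (torsor a).π) (by
      have := h.isOpenImmersion hπ hα g
      have := hπ.etale
      rw [Over.comp_left]
      infer_instance)
  choose V p i hp hi het hsurj using himage
  have hZ (g : Conj) : ∃ f : fixedPiece (torsor a).P (aut a) (g : G) ⟶ fixedLocus Z (g : G),
      f.hom ≫ fixedι Z (g : G) =
        fixedPieceι (torsor a).P (aut a) (g : G) ≫ (torsor a).toZ.hom := by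
    -- On this piece `g` acts as `α`, and `α` preserves the morphism to `Z`; hence the image is
    -- fixed by `g`.
    obtain ⟨f, hf⟩ := exists_fixedι Z (g : G)
      (fixedPieceι (torsor a).P (aut a) (g : G) ≫ (torsor a).toZ.hom) (by
        rw [Category.assoc, ← (torsor a).toZ.comm, ← Category.assoc, ← h.comp_aut, Category.assoc,
          ← Action.comp_hom, aut_toZ])
    refine ⟨⟨f, fun c => ?_⟩, hf⟩
    rw [← cancel_mono (fixedι Z (g : G)), Category.assoc, hf, Category.assoc, fixedι_equivariant,
      ← Category.assoc, h.equivariant, Category.assoc, (torsor a).toZ.comm, ← Category.assoc f, hf,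
      Category.assoc]
  choose f hf using hZ
  exact ⟨⟨(torsor a).U, fun g => ⟨V g, fixedPiece (torsor a).P (aut a) (g : G), p g,
      isTorsor_piece hπ h g (hp g) (hi g) (het g) (hsurj g), f g⟩, i,
      isColimit_images hπ hα hConj h hp hi hsurj⟩,
    { base := Iso.refl _
      j := fun g => fixedPieceι (torsor a).P (aut a) (g : G)
      comm := fun g => (hp g).symm.trans (congrArg _ (Category.comp_id _).symm)
      toZ := fun g => (hf g).symm
      fixed := h }, rfl, rfl⟩

/-- The correspondence between `I([Z/G])` and the disjoint union of the stacks `[Z^g/C(g)]`. -/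
noncomputable def sectorCorrespondence (Z : Action (Over S) G)
    (hConj : Set.BijOn ConjClasses.mk Conj Set.univ) :
    Correspondence (inertia (quotientStack Z))
      (disjointUnion fun g : Conj => quotientStack (fixedLocus Z (g : G))) where
  Rel a y := Comparison (Z := Z) (Conj := Conj) a y
  base r := r.base
  Compat r r' F f := Comparison.Compat r r' F f
  compat_id r := ⟨(Category.id_comp _).trans (Category.comp_id _).symm,
    fun _ => (Category.id_comp _).trans (Category.comp_id _).symm⟩
  compat_comp h h' :=
    ⟨(Category.assoc _ _ _).trans ((congrArg _ h'.1).trans ((Category.assoc _ _ _).symm.trans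
      ((congrArg (· ≫ _) h.1).trans (Category.assoc _ _ _)))),
    fun g => (Category.assoc _ _ _).trans ((congrArg _ (h'.2 g)).trans
      ((Category.assoc _ _ _).symm.trans
      ((congrArg (· ≫ _) (h.2 g)).trans (Category.assoc _ _ _))))⟩
  compat_base h := h.1
  existsUnique_left r r' f := by
    obtain ⟨F, hF⟩ := Comparison.exists_left hConj r r' f
    exact ⟨F, hF, fun _ h => Comparison.unique_left hConj h hF⟩
  existsUnique_right r r' F := by
    obtain ⟨f, hf⟩ := Comparison.exists_right r r' F
    exact ⟨f, hf, fun _ h => Comparison.unique_right h hf⟩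
  exists_left y := exists_comparison_left hConj y
  exists_right a := exists_comparison_right hConj a

end Objects

end StackTheory

theorem mainTheorem10 (S : Scheme.{u}) (G : Type w) [Group G] [Finite G]
    (Z : Action (Over S) G) (Conj : Set G)
    (hConj : Set.BijOn ConjClasses.mk Conj Set.univ) :
    Nonempty (StackTheory.BasedEquivalence
      (StackTheory.inertia (StackTheory.quotientStack Z))
      (StackTheory.disjointUnion fun g : Conj =>
        StackTheory.quotientStack (StackTheory.fixedLocus Z (g : G)))) :=
  ⟨(StackTheory.sectorCorrespondence Z hConj).basedEquivalence⟩
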